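/- Let $X$ be a simplicial complex, that is, a topological space with a triangulation $T$ (a homeomorphism from the geometric realization, with the weak topology, of an abstract simplicial complex of arbitrary size), and let $Y\subseteq X$ be a subcomplex, that is, a union of closed simplices of $T$. Assume: 1. $X\setminus Y$ is dense in $X$. 2. For each $y\in Y$ and each open set $U\subseteq X$ containing $y$, there is an open set $V\subseteq U$ with $y\in V$ such that $V\setminus Y$ is path connected. 3. For each $y\in Y$ there is a path connected open neighbourhood $V$ of $y$ in $X$ such that $\pi_2(V)=0$ and, for each $v\in V\setminus Y$, the map $\pi_1(V\setminus Y,v)\to\pi_1(V,v)$ induced by inclusion is injective. Let $S$ be a compact topological manifold of dimension at most $2$ with (possibly empty) boundary $\partial S$, and let $S'\subseteq S$ be a closed subset containing $\partial S$ such that $S$ admits a triangulation $N$ in which $S'$ is a subcomplex. Let $f\colon S\to X$ be a continuous map with $f(S')\subseteq X\setminus Y$ whose restriction to $S'$ is simplicial with respect to $N$ and $T$: it maps each simplex of $N$ contained in $S'$ onto a simplex of $T$, sending vertices to vertices and linearly in barycentric coordinates. Then there exists a continuous map $h\colon S\to X$ such that $h$ is homotopic to $f$ relative to $S'$ and $h(S)\cap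 Y=\emptyset$. -/

import Mathlib

noncomputable section

namespace AbstractSimplicialComplex

variable {ι : Type*}

/-- The points of the geometric realization `|K|` of an abstract simplicial complex `K`, given by
their barycentric coordinates: finitely supported non-negative functions on the vertices with
total mass `1` whose support is a face of `K`. -/
def Realization (K : AbstractSimplicialComplex ι) : Type _ :=
  {x : ι →₀ ℝ // x.support ∈ K.faces ∧ (∀ i, 0 ≤ x i) ∧ x.sum (fun _ a => a) = 1}

/-- The closed simplex of `|K|` spanned by the vertices in `s`. -/
def Realization.simplex (K : AbstractSimplicialComplex ι) (s : Finset ι) : Set K.Realization :=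
  {x | x.1.support ⊆ s}

/-- The weak (coherent) topology on `|K|`: each closed simplex carries its Euclidean topology
(that of the barycentric coordinates, only finitely many of which are not identically zero on it),
and a subset of `|K|` is open iff its intersection with every closed simplex is open there. -/
instance (K : AbstractSimplicialComplex ι) : TopologicalSpace K.Realization :=
  ⨆ s : K.faces,
    TopologicalSpace.coinduced (Subtype.val : Realization.simplex K s.1 → K.Realization)
      (TopologicalSpace.induced
        (fun (x : Realization.simplex K s.1) (i : ι) => x.1.1 i) inferInstance)

end AbstractSimplicialComplex

/-- A triangulation of the space `Z` with vertices indexed by `ι`: an abstract simplicial complex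
together with a homeomorphism of its geometric realization onto `Z`. -/
structure Triangulation (ι : Type*) (Z : Type*) [TopologicalSpace Z] where
  /-- The underlying abstract simplicial complex. -/
  complex : AbstractSimplicialComplex ι
  /-- The homeomorphism from the geometric realization. -/
  homeo : complex.Realization ≃ₜ Z

namespace Triangulation

variable {ι κ : Type*} {Z W : Type*} [TopologicalSpace Z] [TopologicalSpace W]

/-- The barycentric coordinates of a point of a triangulated space. -/
def coord (T : Triangulation ι Z) (z : Z) : ι →₀ ℝ := (T.homeo.symm z).1

/-- The closed simplex of `Z` with vertex set `s` (meaningful when `s` is a face). -/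
def simplex (T : Triangulation ι Z) (s : Finset ι) : Set Z := {z | (T.coord z).support ⊆ s}

/-- A subcomplex of a triangulated space is a union of simplices of the triangulation. -/
def IsSubcomplex (T : Triangulation ι Z) (A : Set Z) : Prop :=
  ∃ F ⊆ T.complex.faces, A = ⋃ s ∈ F, T.simplex s

open Classical in
/-- `f` is simplicial on the subcomplex `A`: it is induced by a map `φ` of vertices which sends the
vertex set of each simplex of `A` to the vertex set of a simplex of `W`, and `f` is linear in the
barycentric coordinates on each simplex of `A`, that is, `f (∑ aᵢ vᵢ) = ∑ aᵢ φ(vᵢ)`. -/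
def IsSimplicialOn (T : Triangulation κ Z) (T' : Triangulation ι W) (A : Set Z) (f : Z → W) :
    Prop :=
  ∃ φ : κ → ι, ∀ s ∈ T.complex.faces, T.simplex s ⊆ A →
    s.image φ ∈ T'.complex.faces ∧
      ∀ z ∈ T.simplex s, T'.coord (f z) = (T.coord z).mapDomain φ

end Triangulation

end

/-! The map is pushed off `Y` cell by cell, as in the compression lemma for relative homotopy
groups: locally the pair (V, V \ Y) has no obstruction in dimensions 0, 1 and 2. In dimension 0 this
is density of the complement together with local contractibility of X. In dimension 1, a short path
with endpoints off `Y` is replaced by a path in a small path connected set off `Y`; both lie in a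
set contracting inside V, so they are homotopic in V. In dimension 2, exactness of π₂(V) → π₂(V, V \
Y) → π₁(V \ Y) → π₁(V) with π₂(V) = 0 and injectivity on π₁ kills the relative group. Concretely,
the boundary loop of a square is null-homotopic in V, hence bounds a second square off `Y`, and two
squares with the same boundary are homotopic in V relative to it.

The predicate `Compresses` records such a deformation for one ball, and
`exists_homotopy_of_cellExtends` glues deformations along a finite cell structure, keeping some
cells fixed. The gluing is used twice: on a fine grid of a square, which turns local compressibility
of squares into global compressibility (`compresses_square_of_local`), and on the triangulation of S
with the simplices of S' kept fixed (`Triangulation.exists_homotopicRel_off`). Since smallness is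
dealt with inside the squares, the triangulation of S is never subdivided.

Two facts about triangulations complete the argument. X is locally contractible, even where it is
not locally finite (`Triangulation.exists_contractible_nhd`). Simplices of S have at most three
vertices, since a 3-ball does not embed in the plane; this follows from a Borsuk–Ulam argument
(`Triangulation.card_le_three`). -/

section

/-! ### Homotopy extension and compression over a single cell. -/

open Set Metric Topology unitInterval

/-- Homotopy extension for the pair (closed unit ball, unit sphere) of a normed space. -/
theorem ball_homotopy_extension {E X : Type*} [NormedAddCommGroup E] [NormedSpace ℝ E]
    [TopologicalSpace X] {a : ℝ} {G : E × ℝ → X}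
    (hG : ContinuousOn G (closedBall 0 1 ×ˢ {0} ∪ sphere 0 1 ×ˢ Icc 0 a)) :
    ∃ G' : E × ℝ → X, ContinuousOn G' (closedBall 0 1 ×ˢ Icc 0 a) ∧
      (∀ x ∈ closedBall (0 : E) 1, G' (x, 0) = G (x, 0)) ∧
      (∀ x ∈ sphere (0 : E) 1, ∀ t ∈ Icc 0 a, G' (x, t) = G (x, t)) ∧
      MapsTo G' (closedBall 0 1 ×ˢ Icc 0 a)
        (G '' (closedBall 0 1 ×ˢ {0} ∪ sphere 0 1 ×ˢ Icc 0 a)) := by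
  rcases lt_or_ge a 0 with ha | ha
  · refine ⟨G, ?_, fun _ _ => rfl, fun _ _ _ _ => rfl, ?_⟩ <;> simp [Icc_eq_empty_of_lt ha, MapsTo]
  -- The cylinder is projected radially from the point `(0, c)`, strictly above its lid, onto floor
  -- and wall. Dilation about that point by the factor `1 / m` reaches the wall or the floor,
  -- according to which term of the maximum is larger.
  set c : ℝ := a + 1 with hc
  have hc0 : 0 < c := by linarith
  let m : E × ℝ → ℝ := fun p => max ‖p.1‖ ((c - p.2) / c)
  have hm : Continuous m := by fun_prop
  let r : E × ℝ → E × ℝ := fun p => ((m p)⁻¹ • p.1, c - (c - p.2) / m p)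
  have hmpos : ∀ p ∈ (closedBall 0 1 ×ˢ Icc 0 a : Set (E × ℝ)), 0 < m p := by
    rintro ⟨x, t⟩ ⟨-, ht⟩
    refine lt_max_of_lt_right (div_pos ?_ hc0)
    have := ht.2
    simp only at this ⊢
    linarith
  have hr : ContinuousOn r (closedBall 0 1 ×ˢ Icc 0 a) := by
    have h1 : ∀ p ∈ (closedBall 0 1 ×ˢ Icc 0 a : Set (E × ℝ)), m p ≠ 0 :=
      fun p hp => (hmpos p hp).ne'
    exact ((hm.continuousOn.inv₀ h1).smul continuousOn_fst).prodMk
      (continuousOn_const.sub ((continuousOn_const.sub continuousOn_snd).div hm.continuousOn h1))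
  have hmaps : MapsTo r (closedBall 0 1 ×ˢ Icc 0 a)
      (closedBall 0 1 ×ˢ {0} ∪ sphere 0 1 ×ˢ Icc 0 a) := by
    rintro ⟨x, t⟩ hp
    have hpos := hmpos _ hp
    obtain ⟨hx, ht0, hta⟩ := hp
    simp only [mem_closedBall, dist_zero_right] at hx ht0 hta
    have hnorm : ‖(r (x, t)).1‖ = ‖x‖ / m (x, t) := by
      simp only [r, norm_smul, norm_inv, Real.norm_eq_abs, abs_of_pos hpos]
      rw [div_eq_inv_mul]
    rcases le_total ((c - t) / c) ‖x‖ with h | h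
    · right
      have hmx : m (x, t) = ‖x‖ := max_eq_left h
      refine ⟨?_, ?_, ?_⟩
      · rw [mem_sphere_zero_iff_norm, hnorm, hmx]
        exact div_self (hmx ▸ hpos.ne')
      · simp only [r, sub_nonneg]
        rw [div_le_iff₀ hpos, hmx]
        rw [div_le_iff₀ hc0] at h
        linarith
      · simp only [r, hmx]
        have : c - t ≤ (c - t) / ‖x‖ := by
          rw [le_div_iff₀ (hmx ▸ hpos)]
          nlinarith
        linarith
    · left
      have hmx : m (x, t) = (c - t) / c := max_eq_right h
      refine ⟨?_, ?_⟩
      · rw [mem_closedBall, dist_zero_right, hnorm]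
        exact div_le_one_of_le₀ (le_max_left _ _) hpos.le
      · simp only [r, hmx, mem_singleton_iff]
        rw [hmx] at hpos
        have : c - t ≠ 0 := fun h0 => by simp [h0] at hpos
        field_simp
        simp
  refine ⟨G ∘ r, hG.comp hr hmaps, ?_, ?_, fun p hp => ⟨r p, hmaps hp, rfl⟩⟩
  · intro x hx
    have hmx : m (x, 0) = 1 := by
      simp only [m, sub_zero, div_self hc0.ne']
      exact max_eq_right (by simpa using hx)
    simp [r, hmx]
  · intro x hx t ht
    have hmx : m (x, t) = 1 := by
      simp only [m]
      rw [mem_sphere_zero_iff_norm.1 hx]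
      refine max_eq_left (div_le_one_of_le₀ ?_ hc0.le)
      linarith [ht.1]
    simp [r, hmx]

/-- Maps of the unit ball of `E` into `V` with boundary off `Y` can be deformed inside `V`, relative
to the boundary, off `Y`. -/
def Compresses (E : Type*) [NormedAddCommGroup E] {X : Type*} [TopologicalSpace X]
    (Y V : Set X) : Prop :=
  ∀ u : E → X, ContinuousOn u (closedBall 0 1) → MapsTo u (closedBall 0 1) V →
    MapsTo u (sphere 0 1) Yᶜ →
    ∃ K : E × ℝ → X, ContinuousOn K (closedBall 0 1 ×ˢ Icc 0 1) ∧
      MapsTo K (closedBall 0 1 ×ˢ Icc 0 1) V ∧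
      (∀ x ∈ closedBall (0 : E) 1, K (x, 0) = u x) ∧
      (∀ x ∈ sphere (0 : E) 1, ∀ t ∈ Icc (0 : ℝ) 1, K (x, t) = u x) ∧
      ∀ x ∈ closedBall (0 : E) 1, K (x, 1) ∉ Y

/-- A partial homotopy on `A × {0} ∪ ∂A × [0, ∞)` which has become stationary and off `Y` on `∂A`
at time `k` extends over `A × [0, ∞)` to one which is stationary and off `Y` from time `k + 1`. -/
def CellExtends {S X : Type*} [TopologicalSpace S] [TopologicalSpace X] (Y : Set X)
    (A bA : Set S) (V : Set X) (k : ℝ) : Prop :=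
  ∀ G : S × ℝ → X, ContinuousOn G (A ×ˢ {0} ∪ bA ×ˢ Ici 0) →
    MapsTo G (A ×ˢ {0} ∪ bA ×ˢ Ici 0) V →
    (∀ x ∈ bA, ∀ t ≥ k, G (x, t) = G (x, k)) → (∀ x ∈ bA, G (x, k) ∉ Y) →
    ∃ G' : S × ℝ → X, ContinuousOn G' (A ×ˢ Ici 0) ∧ (∀ x ∈ A, G' (x, 0) = G (x, 0)) ∧
      (∀ x ∈ bA, ∀ t ≥ 0, G' (x, t) = G (x, t)) ∧ MapsTo G' (A ×ˢ Ici 0) V ∧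
      (∀ x ∈ A, ∀ t ≥ k + 1, G' (x, t) = G' (x, k + 1)) ∧ ∀ x ∈ A, G' (x, k + 1) ∉ Y

/-- Since `B` is compact and `S` Hausdorff, `B → φ '' B` is proper, and so is its product with the
identity of `J`. The product is therefore closed and surjective, hence a quotient map, with no local
compactness of `J` needed. -/
theorem continuousOn_image_prod_of_comp {E S T X : Type*} [TopologicalSpace E] [TopologicalSpace S]
    [TopologicalSpace T] [TopologicalSpace X] [T2Space S] {φ : E → S} {B : Set E}
    (hB : IsCompact B) (hφ : ContinuousOn φ B) {J : Set T} {G : S × T → X}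
    (h : ContinuousOn (fun p : E × T => G (φ p.1, p.2)) (B ×ˢ J)) :
    ContinuousOn G ((φ '' B) ×ˢ J) := by
  have := isCompact_iff_compactSpace.1 hB
  let φ' : B → φ '' B := fun x => ⟨φ x, x, x.2, rfl⟩
  have hφ' : Continuous φ' := (continuousOn_iff_continuous_domRestrict.1 hφ).subtype_mk _
  let p : B × J → (φ '' B : Set S) × J := Prod.map φ' id
  have hp : IsProperMap p := hφ'.isProperMap.prodMap isProperMap_id
  have hsurj : Function.Surjective p := by
    rintro ⟨⟨_, x, hx, rfl⟩, t⟩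
    exact ⟨(⟨x, hx⟩, t), rfl⟩
  have hq : IsQuotientMap p := hp.isClosedMap.isQuotientMap hp.continuous hsurj
  have key : Continuous fun q : (φ '' B : Set S) × J => G (q.1, q.2) := by
    rw [hq.continuous_iff]
    exact h.comp_continuous (f := fun q : B × J => ((q.1 : E), (q.2 : T))) (by fun_prop)
      fun q => ⟨q.1.2, q.2.2⟩
  rw [continuousOn_iff_continuous_domRestrict]
  exact key.comp (f := fun q : ((φ '' B) ×ˢ J : Set (S × T)) =>
    ((⟨q.1.1, q.2.1⟩, ⟨q.1.2, q.2.2⟩) : (φ '' B : Set S) × J)) (by fun_prop)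

/-- The homotopy is built on the ball and then descends to the cell. Points identified by `φ` may
only lie on the sphere, where the homotopy is `G` composed with `φ` and so respects the
identification. -/
theorem cellExtends_of_characteristicMap {E S X : Type*} [NormedAddCommGroup E] [NormedSpace ℝ E]
    [ProperSpace E] [TopologicalSpace S] [T2Space S] [TopologicalSpace X] {Y V : Set X}
    (hV : Compresses E Y V) {φ : E → S} (hφ : ContinuousOn φ (closedBall 0 1))
    (hinj : ∀ x ∈ closedBall (0 : E) 1, ∀ y ∈ closedBall (0 : E) 1, φ x = φ y →
      x = y ∨ x ∈ sphere 0 1 ∧ y ∈ sphere 0 1) {k : ℝ} (hk : 0 ≤ k) :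
    CellExtends Y (φ '' closedBall 0 1) (φ '' sphere 0 1) V k := by
  intro G hG hGV hstat hoff
  have hmap : MapsTo (fun p : E × ℝ => (φ p.1, p.2))
      (closedBall 0 1 ×ˢ {0} ∪ sphere 0 1 ×ˢ Icc 0 k)
      ((φ '' closedBall 0 1) ×ˢ {0} ∪ (φ '' sphere 0 1) ×ˢ Ici 0) := by
    rintro ⟨x, t⟩ (⟨hx, ht⟩ | ⟨hx, ht⟩)
    · exact Or.inl ⟨mem_image_of_mem _ hx, ht⟩
    · exact Or.inr ⟨mem_image_of_mem _ hx, ht.1⟩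
  have hφ1 : ContinuousOn (fun p : E × ℝ => (φ p.1, p.2)) (closedBall 0 1 ×ˢ univ) :=
    (hφ.comp continuousOn_fst fun p hp => hp.1).prodMk continuousOn_snd
  obtain ⟨G₁, hG₁, hG₁0, hG₁s, hG₁V⟩ := ball_homotopy_extension (a := k)
    (hG.comp (hφ1.mono (by
      rintro ⟨x, t⟩ (⟨hx, ht⟩ | ⟨hx, ht⟩)
      · exact ⟨hx, trivial⟩
      · exact ⟨sphere_subset_closedBall hx, trivial⟩)) hmap)
  replace hG₁V : MapsTo G₁ (closedBall 0 1 ×ˢ Icc 0 k) V := by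
    intro p hp
    obtain ⟨q, hq, h⟩ := hG₁V hp
    rw [← h]
    exact hGV (hmap hq)
  obtain ⟨K, hK, hKV, hK0, hKs, hK1⟩ := hV (fun x => G₁ (x, k))
    (hG₁.comp (by fun_prop) fun x hx => ⟨hx, hk, le_rfl⟩) (fun x hx => hG₁V ⟨hx, hk, le_rfl⟩)
    (fun x hx => by
      have := hG₁s x hx k ⟨hk, le_rfl⟩
      simp only [mem_compl_iff, this]
      exact hoff _ (mem_image_of_mem _ hx))
  classical
  -- Homotopy extension is used until time `k`, when the boundary is off `Y`; the compression runs
  -- during `[k, k + 1]`, and the minimum freezes it afterwards.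
  let F : E × ℝ → X := fun p => if p.2 ≤ k then G₁ p else K (p.1, min (p.2 - k) 1)
  have hFle : ∀ x t, t ≤ k → F (x, t) = G₁ (x, t) := fun x t ht => if_pos ht
  have hFge : ∀ x ∈ closedBall (0 : E) 1, ∀ t, k ≤ t → F (x, t) = K (x, min (t - k) 1) := by
    intro x hx t ht
    rcases ht.eq_or_lt with rfl | h
    · simp [F, hK0 x hx]
    · exact if_neg h.not_ge
  have hF : ContinuousOn F (closedBall 0 1 ×ˢ Ici 0) := by
    have h1 : ContinuousOn F (closedBall 0 1 ×ˢ Icc 0 k) :=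
      hG₁.congr fun p hp => hFle _ _ hp.2.2
    have h2 : ContinuousOn F (closedBall 0 1 ×ˢ Ici k) := by
      refine ContinuousOn.congr (f := fun p : E × ℝ => K (p.1, min (p.2 - k) 1))
        (hK.comp (by fun_prop) ?_) fun p hp => hFge _ hp.1 _ hp.2
      intro p hp
      exact ⟨hp.1, le_min (sub_nonneg.2 hp.2) zero_le_one, min_le_right _ _⟩
    refine (h1.union_of_isClosed h2 (isClosed_closedBall.prod isClosed_Icc)
      (isClosed_closedBall.prod isClosed_Ici)).mono ?_
    rw [← prod_union]
    refine prod_mono_right fun t ht => ?_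
    rcases le_total t k with h | h
    · exact Or.inl ⟨ht, h⟩
    · exact Or.inr h
  have hFs : ∀ x ∈ sphere (0 : E) 1, ∀ t ≥ 0, F (x, t) = G (φ x, t) := by
    intro x hx t ht
    rcases le_total t k with h | h
    · rw [hFle _ _ h, hG₁s x hx t ⟨ht, h⟩]
      rfl
    · rw [hFge _ (sphere_subset_closedBall hx) _ h,
        hKs x hx _ ⟨le_min (sub_nonneg.2 h) zero_le_one, min_le_right _ _⟩,
        hG₁s x hx k ⟨hk, le_rfl⟩, hstat _ (mem_image_of_mem _ hx) t h]
      rfl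
  -- An arbitrary section of `φ` suffices, because `F` is constant on the fibres of `φ`.
  choose! ψ hψ using fun s (hs : s ∈ φ '' closedBall (0 : E) 1) => hs
  have hFψ : ∀ x ∈ closedBall (0 : E) 1, ∀ t ≥ 0, F (ψ (φ x), t) = F (x, t) := by
    intro x hx t ht
    obtain ⟨hy, hxy⟩ := hψ _ (mem_image_of_mem φ hx)
    rcases hinj _ hy _ hx hxy with h | ⟨h1, h2⟩
    · rw [h]
    · rw [hFs _ h1 t ht, hFs _ h2 t ht, hxy]
  refine ⟨fun p => F (ψ p.1, p.2), ?_, ?_, ?_, ?_, ?_, ?_⟩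
  · exact continuousOn_image_prod_of_comp (isCompact_closedBall 0 1) hφ
      (hF.congr fun p hp => hFψ _ hp.1 _ hp.2)
  · rintro _ ⟨x, hx, rfl⟩
    simp only
    rw [hFψ x hx 0 le_rfl, hFle _ _ hk, hG₁0 x hx]
    rfl
  · rintro _ ⟨x, hx, rfl⟩ t ht
    simp only
    rw [hFψ x (sphere_subset_closedBall hx) t ht, hFs x hx t ht]
  · rintro ⟨_, t⟩ ⟨⟨x, hx, rfl⟩, ht⟩
    simp only
    rw [hFψ x hx t ht]
    rcases le_total t k with h | h
    · rw [hFle _ _ h]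
      exact hG₁V ⟨hx, ht, h⟩
    · rw [hFge _ hx _ h]
      exact hKV ⟨hx, le_min (sub_nonneg.2 h) zero_le_one, min_le_right _ _⟩
  · rintro _ ⟨x, hx, rfl⟩ t ht
    simp only
    rw [hFψ x hx t (by linarith), hFψ x hx _ (by linarith), hFge _ hx _ (by linarith),
      hFge _ hx _ (by linarith), min_eq_right (by linarith), min_eq_right (by linarith)]
  · rintro _ ⟨x, hx, rfl⟩
    simp only
    rw [hFψ x hx _ (by linarith), hFge _ hx _ (by linarith), min_eq_right (by linarith)]
    exact hK1 x hx

end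

/-! ### Gluing over a finite cell structure. -/

section

open Set Metric Topology unitInterval

/-- Cell-by-cell construction of a homotopy on a finite cell structure which pushes `f` off `Y`,
inside prescribed sets `V c`, and which is constant on a given family `Z` of cells. -/
theorem exists_homotopy_of_cellExtends {S X C : Type*} [TopologicalSpace S] [TopologicalSpace X]
    [Finite C] {Y : Set X} (rank : C → ℕ) (face : C → C → Prop) (e : C → Set S) (V : C → Set X)
    (Z : C → Prop) (hclosed : ∀ c, IsClosed (e c))
    (hrank : ∀ b c, face b c → rank b < rank c) (hsub : ∀ b c, face b c → e b ⊆ e c)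
    (hV : ∀ b c, face b c → V b ⊆ V c) (hZ : ∀ b c, face b c → Z c → Z b)
    (hint : ∀ c d, d ≠ c → rank d ≤ rank c → e d ∩ e c ⊆ ⋃ b ∈ {b | face b c}, e b)
    {f : S → X} (hf : ContinuousOn f (⋃ c, e c)) (hfV : ∀ c, MapsTo f (e c) (V c))
    (hfZ : ∀ c, Z c → ∀ x ∈ e c, f x ∉ Y)
    (hext : ∀ c, ¬ Z c → CellExtends Y (e c) (⋃ b ∈ {b | face b c}, e b) (V c) (rank c)) :
    ∃ F : S × ℝ → X, ContinuousOn F ((⋃ c, e c) ×ˢ Ici 0) ∧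
      ∀ c, ∀ x ∈ e c, F (x, 0) = f x ∧ (Z c → ∀ t ≥ 0, F (x, t) = f x) ∧
        (∀ t ≥ 0, F (x, t) ∈ V c) ∧ (∀ t ≥ (rank c + 1 : ℝ), F (x, t) = F (x, rank c + 1)) ∧
        F (x, rank c + 1) ∉ Y := by
  classical
  have _ := Fintype.ofFinite C
  -- Cells are attached in order of increasing rank: the faces of the new cell are then already
  -- present, and by `hint` it meets the earlier cells only in its boundary.
  suffices H : ∀ D : Finset C, (∀ b c, face b c → c ∈ D → b ∈ D) →
      ∃ F : S × ℝ → X, ContinuousOn F ((⋃ c ∈ D, e c) ×ˢ Ici 0) ∧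
      ∀ c ∈ D, ∀ x ∈ e c, F (x, 0) = f x ∧ (Z c → ∀ t ≥ 0, F (x, t) = f x) ∧
        (∀ t ≥ 0, F (x, t) ∈ V c) ∧ (∀ t ≥ (rank c + 1 : ℝ), F (x, t) = F (x, rank c + 1)) ∧
        F (x, rank c + 1) ∉ Y by
    obtain ⟨F, h1, h2⟩ := H Finset.univ (by simp)
    exact ⟨F, by simpa using h1, fun c => h2 c (Finset.mem_univ c)⟩
  intro D
  induction D using Finset.induction_on_max_value rank with
  | empty => exact fun _ => ⟨fun p => f p.1, by simp, by simp⟩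
  | insert a D haD hmax ih =>
    intro hD
    have hbD : ∀ b, face b a → b ∈ D := fun b hb => by
      rcases Finset.mem_insert.1 (hD b a hb (Finset.mem_insert_self _ _)) with rfl | h
      · exact absurd (hrank _ _ hb) (lt_irrefl _)
      · exact h
    obtain ⟨F, hF, hFc⟩ := ih fun b c hbc hc => by
      rcases Finset.mem_insert.1 (hD b c hbc (Finset.mem_insert_of_mem hc)) with rfl | h
      · exact absurd (hrank _ _ hbc) (hmax c hc).not_gt
      · exact h
    set bA : Set S := ⋃ b ∈ {b | face b a}, e b with hbA
    set A : Set S := ⋃ c ∈ D, e c with hA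
    have hbA_sub : bA ⊆ A := iUnion₂_subset fun b hb => subset_biUnion_of_mem (u := e) (hbD b hb)
    have hbA_sub' : bA ⊆ e a := iUnion₂_subset fun b hb => hsub b a hb
    have hbA_closed : IsClosed bA := (toFinite _).isClosed_biUnion fun b _ => hclosed b
    have hA_closed : IsClosed A := D.finite_toSet.isClosed_biUnion fun b _ => hclosed b
    have hAa : A ∩ e a ⊆ bA := by
      rintro x ⟨hx, hxa⟩
      obtain ⟨d, hd, hxd⟩ := mem_iUnion₂.1 hx
      exact hint a d (fun h => haD (h ▸ hd)) (hmax d hd) ⟨hxd, hxa⟩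
    have hmem : ∀ x ∈ bA, ∃ b, face b a ∧ x ∈ e b := fun x hx => by simpa [hbA] using hx
    have hfa : ContinuousOn f (e a) := hf.mono (subset_iUnion e a)
    obtain ⟨G', hG', hG'F, hG'a⟩ : ∃ G' : S × ℝ → X, ContinuousOn G' (e a ×ˢ Ici 0) ∧
        (∀ x ∈ bA, ∀ t ≥ 0, G' (x, t) = F (x, t)) ∧
        ∀ x ∈ e a, G' (x, 0) = f x ∧ (Z a → ∀ t ≥ 0, G' (x, t) = f x) ∧
        (∀ t ≥ 0, G' (x, t) ∈ V a) ∧ (∀ t ≥ (rank a + 1 : ℝ), G' (x, t) = G' (x, rank a + 1)) ∧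
        G' (x, rank a + 1) ∉ Y := by
      by_cases hz : Z a
      · refine ⟨fun p => f p.1, hfa.comp continuousOn_fst fun p hp => hp.1, ?_, ?_⟩
        · intro x hx t ht
          obtain ⟨b, hb, hxb⟩ := hmem x hx
          exact ((hFc b (hbD b hb) x hxb).2.1 (hZ b a hb hz) t ht).symm
        · exact fun x hx => ⟨rfl, fun _ _ _ => rfl, fun _ _ => hfV a hx, fun _ _ => rfl,
            hfZ a hz x hx⟩
      -- The data for `hext`: the homotopy already built on the boundary, and `f` at time 0 on the
      -- whole cell.
      · let G : S × ℝ → X := fun p => if p.1 ∈ bA then F p else f p.1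
        have hGb : ∀ x ∈ bA, ∀ t, G (x, t) = F (x, t) := fun x hx t => if_pos hx
        have hG0 : ∀ x ∈ e a, G (x, 0) = f x := by
          intro x hx
          by_cases hxb : x ∈ bA
          · obtain ⟨b, hb, hxb'⟩ := hmem x hxb
            rw [hGb x hxb]
            exact (hFc b (hbD b hb) x hxb').1
          · exact if_neg hxb
        have hGc : ContinuousOn G (e a ×ˢ {0} ∪ bA ×ˢ Ici 0) := by
          refine ContinuousOn.union_of_isClosed ?_ ?_ ((hclosed a).prod isClosed_singleton)
            (hbA_closed.prod isClosed_Ici)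
          · refine (hfa.comp continuousOn_fst fun p hp => hp.1).congr ?_
            rintro ⟨x, t⟩ ⟨hx, ht⟩
            obtain rfl : t = 0 := ht
            exact hG0 x hx
          · exact (hF.mono (prod_mono_left hbA_sub)).congr fun p hp => hGb _ hp.1 _
        obtain ⟨G', h1, h2, h3, h4, h5, h6⟩ := hext a hz G hGc (by
          rintro ⟨x, t⟩ (⟨hx, ht⟩ | ⟨hx, ht⟩)
          · obtain rfl : t = 0 := ht
            rw [hG0 x hx]
            exact hfV a hx
          · obtain ⟨b, hb, hxb⟩ := hmem x hx
            rw [hGb x hx]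
            exact hV b a hb ((hFc b (hbD b hb) x hxb).2.2.1 t ht)) (by
          intro x hx t ht
          obtain ⟨b, hb, hxb⟩ := hmem x hx
          -- A proper face comes to rest at its rank plus one, hence no later than time `rank a`,
          -- the time at which `hext` wants the boundary at rest and off `Y`.
          have hr : (rank b + 1 : ℝ) ≤ rank a := by exact_mod_cast hrank b a hb
          have := (hFc b (hbD b hb) x hxb).2.2.2.1
          rw [hGb x hx, hGb x hx, this t (hr.trans ht), this _ hr]) (by
          intro x hx
          obtain ⟨b, hb, hxb⟩ := hmem x hx
          have hr : (rank b + 1 : ℝ) ≤ rank a := by exact_mod_cast hrank b a hb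
          obtain ⟨-, -, -, this, this'⟩ := (hFc b (hbD b hb) x hxb)
          rw [hGb x hx, this _ hr]
          exact this')
        refine ⟨G', h1, fun x hx t ht => (h3 x hx t ht).trans (hGb x hx t), fun x hx =>
          ⟨(h2 x hx).trans (hG0 x hx), fun h => absurd h hz, fun t ht => h4 ⟨hx, ht⟩, h5 x hx,
            h6 x hx⟩⟩
    let F' : S × ℝ → X := fun p => if p.1 ∈ A then F p else G' p
    have hF'A : ∀ x ∈ A, ∀ t, F' (x, t) = F (x, t) := fun x hx t => if_pos hx
    have hF'a : ∀ x ∈ e a, ∀ t ≥ 0, F' (x, t) = G' (x, t) := by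
      intro x hx t ht
      by_cases hxA : x ∈ A
      · rw [hF'A x hxA, hG'F x (hAa ⟨hxA, hx⟩) t ht]
      · exact if_neg hxA
    refine ⟨F', ?_, ?_⟩
    · rw [Finset.set_biUnion_insert, union_prod]
      exact (hG'.congr fun p hp => hF'a _ hp.1 _ hp.2).union_of_isClosed
        (hF.congr fun p hp => hF'A _ hp.1 _) ((hclosed a).prod isClosed_Ici)
        (hA_closed.prod isClosed_Ici)
    · intro c hc x hx
      have h0 : (0 : ℝ) ≤ rank c + 1 := by positivity
      rcases Finset.mem_insert.1 hc with rfl | hc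
      · obtain ⟨h1, h2, h3, h4, h5⟩ := hG'a x hx
        refine ⟨(hF'a x hx 0 le_rfl).trans h1, fun hz t ht => (hF'a x hx t ht).trans (h2 hz t ht),
          fun t ht => hF'a x hx t ht ▸ h3 t ht, fun t ht => ?_, ?_⟩
        · rw [hF'a x hx t (h0.trans ht), hF'a x hx _ h0, h4 t ht]
        · rwa [hF'a x hx _ h0]
      · have hxA : x ∈ A := mem_iUnion₂.2 ⟨c, hc, hx⟩
        simpa only [hF'A x hxA] using hFc c hc x hx

end

/-! ### Compressing squares by means of π₁ and π₂. -/

section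

open Set Metric Topology unitInterval

/-- The standard parametrization of the unit sphere (boundary of a square) of `ℝ × ℝ`. -/
noncomputable def squareLoop (t : ℝ) : ℝ × ℝ :=
  ‖(Real.cos (2 * Real.pi * t), Real.sin (2 * Real.pi * t))‖⁻¹ •
    (Real.cos (2 * Real.pi * t), Real.sin (2 * Real.pi * t))

theorem cos_sin_ne_zero (θ : ℝ) : ((Real.cos θ, Real.sin θ) : ℝ × ℝ) ≠ 0 := by
  intro h
  obtain ⟨h1, h2⟩ := Prod.mk_eq_zero.1 h
  have := Real.sin_sq_add_cos_sq θ
  simp [h1, h2] at this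

theorem continuous_squareLoop : Continuous squareLoop := by
  have h : Continuous fun t : ℝ => ((Real.cos (2 * Real.pi * t), Real.sin (2 * Real.pi * t)) : ℝ × ℝ) := by
    fun_prop
  exact (h.norm.inv₀ fun t => norm_ne_zero_iff.2 (cos_sin_ne_zero _)).smul h

theorem norm_squareLoop (t : ℝ) : ‖squareLoop t‖ = 1 := by
  rw [squareLoop, norm_smul, norm_inv, norm_norm,
    inv_mul_cancel₀ (norm_ne_zero_iff.2 (cos_sin_ne_zero _))]

theorem squareLoop_mem_sphere (t : ℝ) : squareLoop t ∈ sphere (0 : ℝ × ℝ) 1 := by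
  simp [norm_squareLoop]

theorem squareLoop_one : squareLoop 1 = squareLoop 0 := by
  simp [squareLoop]

/-- Equal values lie on one ray, so the two points of the round circle are positive multiples of
each other and hence equal. The angles then differ by an integral number of turns, which lies
between -1 and 1. -/
theorem squareLoop_injective {s t : ℝ} (hs : s ∈ Icc (0 : ℝ) 1) (ht : t ∈ Icc (0 : ℝ) 1)
    (h : squareLoop s = squareLoop t) : s = t ∨ s = 0 ∧ t = 1 ∨ s = 1 ∧ t = 0 := by
  have key : ∃ r > 0, Real.cos (2 * Real.pi * s) = r * Real.cos (2 * Real.pi * t) ∧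
      Real.sin (2 * Real.pi * s) = r * Real.sin (2 * Real.pi * t) := by
    have hps := norm_pos_iff.2 (cos_sin_ne_zero (2 * Real.pi * s))
    have hpt := norm_pos_iff.2 (cos_sin_ne_zero (2 * Real.pi * t))
    refine ⟨_ / _, div_pos hps hpt, ?_⟩
    unfold squareLoop at h
    rw [Prod.ext_iff] at h
    simp only [Prod.smul_mk, smul_eq_mul] at h
    generalize ‖((Real.cos (2 * Real.pi * s), Real.sin (2 * Real.pi * s)) : ℝ × ℝ)‖ = a at *
    generalize ‖((Real.cos (2 * Real.pi * t), Real.sin (2 * Real.pi * t)) : ℝ × ℝ)‖ = b at *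
    obtain ⟨h1, h2⟩ := h
    have hb := hpt.ne'
    have ha := hps.ne'
    constructor
    · field_simp at h1 ⊢
      linarith
    · field_simp at h2 ⊢
      linarith
  obtain ⟨r, hr, h1, h2⟩ := key
  have hr1 : r = 1 := by
    have e1 := Real.sin_sq_add_cos_sq (2 * Real.pi * s)
    have e2 := Real.sin_sq_add_cos_sq (2 * Real.pi * t)
    rw [h1, h2] at e1
    have : r ^ 2 = 1 := by linear_combination e1 - r ^ 2 * e2
    nlinarith
  rw [hr1, one_mul] at h1 h2
  have h3 := Real.Angle.cos_sin_inj h1 h2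
  rw [Real.Angle.angle_eq_iff_two_pi_dvd_sub] at h3
  obtain ⟨k, hk⟩ := h3
  have hk' : s - t = k := by
    have := Real.pi_pos
    have h4 : (2 * Real.pi) * (s - t) = (2 * Real.pi) * k := by linarith
    exact mul_left_cancel₀ (by positivity) h4
  have h5 : (k : ℝ) ≤ 1 := by linarith [hs.2, ht.1]
  have h6 : (-1 : ℝ) ≤ k := by linarith [hs.1, ht.2]
  have h7 : k ≤ 1 := by exact_mod_cast h5
  have h8 : -1 ≤ k := by exact_mod_cast h6
  obtain rfl | rfl | rfl : k = -1 ∨ k = 0 ∨ k = 1 := by omega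
  · right; left
    push_cast at hk'
    constructor <;> linarith [hs.1, ht.2]
  · left
    push_cast at hk'
    linarith
  · right; right
    push_cast at hk'
    constructor <;> linarith [hs.2, ht.1]

theorem exists_squareLoop_eq (z : ℝ × ℝ) : ∃ t ∈ Icc (0 : ℝ) 1, ‖z‖ • squareLoop t = z := by
  by_cases hz : z = 0
  · exact ⟨0, by simp, by simp [hz]⟩
  let w : ℂ := ⟨z.1, z.2⟩
  have hw : w ≠ 0 := fun h => hz (Prod.ext (congrArg Complex.re h) (congrArg Complex.im h))
  have hpi := Real.pi_pos
  obtain ⟨θ, hθ, h1, h2⟩ : ∃ θ ∈ Icc 0 (2 * Real.pi), ‖w‖ * Real.cos θ = z.1 ∧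
      ‖w‖ * Real.sin θ = z.2 := by
    rcases le_total 0 (Complex.arg w) with h | h
    · exact ⟨_, ⟨h, by linarith [Complex.arg_le_pi w]⟩, Complex.norm_mul_cos_arg w,
        Complex.norm_mul_sin_arg w⟩
    · refine ⟨Complex.arg w + 2 * Real.pi, ⟨by linarith [Complex.neg_pi_lt_arg w], by linarith⟩, ?_⟩
      rw [Real.cos_add_two_pi, Real.sin_add_two_pi]
      exact ⟨Complex.norm_mul_cos_arg w, Complex.norm_mul_sin_arg w⟩
  refine ⟨θ / (2 * Real.pi), ⟨div_nonneg hθ.1 (by positivity),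
    div_le_one_of_le₀ hθ.2 (by positivity)⟩, ?_⟩
  have hz' : z = ‖w‖ • ((Real.cos θ, Real.sin θ) : ℝ × ℝ) := Prod.ext h1.symm h2.symm
  have e : 2 * Real.pi * (θ / (2 * Real.pi)) = θ := by field_simp
  have hwn := norm_pos_iff.2 hw
  rw [squareLoop, e]
  conv_rhs => rw [hz']
  rw [hz', norm_smul, norm_norm, smul_smul, mul_assoc,
    mul_inv_cancel₀ (norm_ne_zero_iff.2 (cos_sin_ne_zero _)), mul_one]

/-- A null-homotopic loop extends over the square. -/
theorem exists_filling_of_homotopic_refl {A : Type*} [TopologicalSpace A] {a : A} {γ : Path a a}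
    (h : γ.Homotopic (Path.refl a)) :
    ∃ w : ℝ × ℝ → A, ContinuousOn w (closedBall 0 1) ∧ ∀ t : I, w (squareLoop t) = γ t := by
  obtain ⟨F⟩ := h
  -- The first variable is the radius. The reversal `σ` puts the constant end of the homotopy at the
  -- centre and `γ` on the boundary, so that `K` factors through polar coordinates.
  let K : I × I → A := fun p => F (σ p.1, p.2)
  have hK : Continuous K := by fun_prop
  let polar : I × I → closedBall (0 : ℝ × ℝ) 1 := fun p =>
    ⟨(p.1 : ℝ) • squareLoop p.2, by
      rw [mem_closedBall_zero_iff, norm_smul, norm_squareLoop, mul_one, Real.norm_eq_abs,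
        abs_of_nonneg p.1.2.1]
      exact p.1.2.2⟩
  have hpolar : Continuous polar := by
    have := continuous_squareLoop
    exact Continuous.subtype_mk (by fun_prop) _
  have hsurj : Function.Surjective polar := by
    rintro ⟨z, hz⟩
    obtain ⟨t, ht, h⟩ := exists_squareLoop_eq z
    exact ⟨(⟨‖z‖, norm_nonneg _, by simpa using hz⟩, ⟨t, ht⟩), Subtype.ext h⟩
  have hq : IsQuotientMap polar := hpolar.isClosedMap.isQuotientMap hpolar hsurj
  have hcompat : ∀ p q : I × I, polar p = polar q → K p = K q := by
    rintro ⟨s, t⟩ ⟨s', t'⟩ h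
    have h1 : (s : ℝ) • squareLoop t = (s' : ℝ) • squareLoop t' := congrArg Subtype.val h
    have h2 : s = s' := by
      have := congrArg norm h1
      simp only [norm_smul, norm_squareLoop, mul_one, Real.norm_eq_abs] at this
      rw [abs_of_nonneg s.2.1, abs_of_nonneg s'.2.1] at this
      exact Subtype.ext this
    subst h2
    by_cases hs : s = 0
    · simp [K, hs]
    · have hs' : (s : ℝ) ≠ 0 := fun h => hs (Subtype.ext h)
      have h3 := squareLoop_injective t.2 t'.2 (smul_right_injective _ hs' h1)
      have c1 : ∀ r : I, (r : ℝ) = 0 → K (s, r) = a := by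
        intro r hr
        obtain rfl : r = 0 := Subtype.ext hr
        simp [K]
      have c2 : ∀ r : I, (r : ℝ) = 1 → K (s, r) = a := by
        intro r hr
        obtain rfl : r = 1 := Subtype.ext hr
        simp [K]
      rcases h3 with h3 | ⟨h3, h4⟩ | ⟨h3, h4⟩
      · rw [Subtype.ext h3]
      · rw [c1 t h3, c2 t' h4]
      · rw [c2 t h3, c1 t' h4]
  let w' : closedBall (0 : ℝ × ℝ) 1 → A := fun z => K (Function.surjInv hsurj z)
  have hw' : ∀ p, w' (polar p) = K p := fun p => hcompat _ _ (Function.surjInv_eq hsurj _)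
  have hw'c : Continuous w' := by
    rw [hq.continuous_iff]
    exact hK.congr fun p => (hw' p).symm
  classical
  refine ⟨fun z => if hz : z ∈ closedBall (0 : ℝ × ℝ) 1 then w' ⟨z, hz⟩ else a, ?_, ?_⟩
  · rw [continuousOn_iff_continuous_domRestrict]
    refine hw'c.congr ?_
    rintro ⟨z, hz⟩
    simp only [domRestrict_apply, dif_pos hz]
  · intro t
    have ht := sphere_subset_closedBall (squareLoop_mem_sphere t)
    have : (⟨squareLoop t, ht⟩ : closedBall (0 : ℝ × ℝ) 1) = polar (1, t) := by
      simp [polar]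
    simp only [dif_pos ht, this, hw']
    simp [K]

/-- The boundary loop of a map on the square is null-homotopic. -/
theorem homotopic_refl_of_filling {A : Type*} [TopologicalSpace A] {u : ℝ × ℝ → A}
    (hu : ContinuousOn u (closedBall 0 1)) {a : A} {γ : Path a a}
    (h : ∀ t : I, γ t = u (squareLoop t)) : γ.Homotopic (Path.refl a) := by
  have : ContractibleSpace (closedBall (0 : ℝ × ℝ) 1) :=
    (convex_closedBall 0 1).contractibleSpace ⟨0, by simp⟩
  let u' : C(closedBall (0 : ℝ × ℝ) 1, A) :=
    ⟨_, continuousOn_iff_continuous_domRestrict.1 hu⟩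
  let b : closedBall (0 : ℝ × ℝ) 1 :=
    ⟨squareLoop 0, sphere_subset_closedBall (squareLoop_mem_sphere 0)⟩
  let δ : Path b b :=
    { toFun := fun t => ⟨squareLoop t, sphere_subset_closedBall (squareLoop_mem_sphere t)⟩
      continuous_toFun := by
        have := continuous_squareLoop
        exact Continuous.subtype_mk (by fun_prop) _
      source' := by simp [b]
      target' := by simp [b, squareLoop_one] }
  have hab : a = u' b := by
    have := h 0
    simpa [u', b] using this
  have h1 := ((SimplyConnectedSpace.paths_homotopic δ (Path.refl b)).map u').pathCast hab hab
  convert h1 using 1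
  · ext t
    exact h t
  · ext t
    exact hab

/-- In a space with trivial `π₂`, two maps of the square with the same boundary values are
homotopic relative to the boundary. -/
theorem exists_homotopy_of_pi_two_subsingleton {A : Type*} [TopologicalSpace A]
    (hA : ∀ a : A, Subsingleton (HomotopyGroup.Pi 2 A a)) {u w : ℝ × ℝ → A}
    (hu : ContinuousOn u (closedBall 0 1)) (hw : ContinuousOn w (closedBall 0 1))
    (huw : EqOn u w (sphere 0 1)) :
    ∃ K : (ℝ × ℝ) × ℝ → A, ContinuousOn K (closedBall 0 1 ×ˢ Icc 0 1) ∧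
      (∀ x ∈ closedBall (0 : ℝ × ℝ) 1, K (x, 0) = u x) ∧
      (∀ x ∈ sphere (0 : ℝ × ℝ) 1, ∀ t ∈ Icc (0 : ℝ) 1, K (x, t) = u x) ∧
      ∀ x ∈ closedBall (0 : ℝ × ℝ) 1, K (x, 1) = w x := by
  classical
  have hsmul : ∀ s ∈ Icc (0 : ℝ) 1, ∀ x ∈ closedBall (0 : ℝ × ℝ) 1,
      s • x ∈ closedBall (0 : ℝ × ℝ) 1 := by
    intro s hs x hx
    rw [mem_closedBall_zero_iff] at hx ⊢
    rw [norm_smul, Real.norm_eq_abs, abs_of_nonneg hs.1]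
    exact mul_le_one₀ hs.2 (norm_nonneg _) hx
  have h1s : ∀ s ∈ Icc (0 : ℝ) 1, 1 - s ∈ Icc (0 : ℝ) 1 := fun s hs =>
    ⟨by linarith [hs.2], by linarith [hs.1]⟩
  -- drag `w` along the contraction of `u`
  obtain ⟨W, hW, hW0, hWs, -⟩ := ball_homotopy_extension (a := 1) (E := ℝ × ℝ) (X := A)
    (G := fun p => if p.2 = 0 then w p.1 else u ((1 - p.2) • p.1)) (by
      refine ContinuousOn.union_of_isClosed ?_ ?_ (isClosed_closedBall.prod isClosed_singleton)
        (isClosed_sphere.prod isClosed_Icc)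
      · exact (hw.comp continuousOn_fst fun p hp => hp.1).congr fun p hp => if_pos hp.2
      · refine ContinuousOn.congr (f := fun p => u ((1 - p.2) • p.1))
          (hu.comp (by fun_prop) fun p hp => hsmul _ (h1s _ hp.2) _ (sphere_subset_closedBall hp.1))
          fun p hp => ?_
        simp only
        split_ifs with h
        · simp [h, huw hp.1]
        · rfl)
  replace hW0 : ∀ x ∈ closedBall (0 : ℝ × ℝ) 1, W (x, 0) = w x := fun x hx => by
    simpa using hW0 x hx
  replace hWs : ∀ x ∈ sphere (0 : ℝ × ℝ) 1, ∀ t ∈ Icc (0 : ℝ) 1, W (x, t) = u ((1 - t) • x) := by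
    intro x hx t ht
    rw [hWs x hx t ht]
    simp only
    split_ifs with h
    · simp [h, huw hx]
    · rfl
  set a : A := u 0 with ha
  -- the resulting map is a two-dimensional loop
  let sq : (Fin 2 → I) → ℝ × ℝ := fun z => (2 * (z 0 : ℝ) - 1, 2 * (z 1 : ℝ) - 1)
  have hsq : Continuous sq := by fun_prop
  have hI : ∀ t : I, |2 * (t : ℝ) - 1| ≤ 1 := fun t =>
    abs_le.2 ⟨by linarith [t.2.1], by linarith [t.2.2]⟩
  have hsqB : ∀ z, sq z ∈ closedBall (0 : ℝ × ℝ) 1 := by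
    intro z
    rw [mem_closedBall_zero_iff, Prod.norm_def]
    exact max_le (hI _) (hI _)
  have hsqS : ∀ z, z ∈ Cube.boundary (Fin 2) ↔ sq z ∈ sphere (0 : ℝ × ℝ) 1 := by
    intro z
    have h1 : ∀ t : I, |2 * (t : ℝ) - 1| = 1 ↔ t = 0 ∨ t = 1 := by
      intro t
      rw [abs_eq zero_le_one, Subtype.ext_iff, Subtype.ext_iff]
      simp only [Icc.coe_zero, Icc.coe_one]
      constructor
      · rintro (h | h)
        · right; linarith
        · left; linarith
      · rintro (h | h) <;> rw [h] <;> norm_num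
    simp only [Cube.boundary, mem_ofPred_eq, Fin.exists_fin_two, mem_sphere_zero_iff_norm,
      Prod.norm_def, sq, Real.norm_eq_abs]
    rw [← h1, ← h1]
    constructor
    · rintro (h | h)
      · rw [h]; exact max_eq_left (hI _)
      · rw [h]; exact max_eq_right (hI _)
    · intro h
      rcases max_choice (|2 * (z 0 : ℝ) - 1|) (|2 * (z 1 : ℝ) - 1|) with h' | h'
      · left; rw [← h']; exact h
      · right; rw [← h']; exact h
  have hcont : Continuous fun z : Fin 2 → I => W (sq z, 1) :=
    hW.comp_continuous (by fun_prop) fun z => ⟨hsqB z, by simp⟩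
  let g : GenLoop (Fin 2) A a := ⟨⟨_, hcont⟩, by
    intro z hz
    have := hWs _ ((hsqS z).1 hz) 1 (by simp)
    simpa [ha] using this⟩
  obtain ⟨L⟩ : GenLoop.Homotopic g GenLoop.const :=
    Quotient.exact (@Subsingleton.elim _ (hA a) (Quotient.mk _ g) (Quotient.mk _ GenLoop.const))
  let qs : ℝ × ℝ → (Fin 2 → I) := fun x =>
    ![projIcc 0 1 zero_le_one ((1 + x.1) / 2), projIcc 0 1 zero_le_one ((1 + x.2) / 2)]
  have hqs : Continuous qs := by
    refine continuous_pi fun i => ?_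
    fin_cases i
    · exact (continuous_projIcc (h := zero_le_one)).comp
        (by fun_prop : Continuous fun x : ℝ × ℝ => (1 + x.1) / 2)
    · exact (continuous_projIcc (h := zero_le_one)).comp
        (by fun_prop : Continuous fun x : ℝ × ℝ => (1 + x.2) / 2)
  have hcoe : ∀ r : ℝ, |r| ≤ 1 → 2 * (projIcc 0 1 zero_le_one ((1 + r) / 2) : ℝ) - 1 = r := by
    intro r hr
    rw [abs_le] at hr
    rw [coe_projIcc, min_eq_right (by linarith), max_eq_right (by linarith)]
    ring
  have hsqqs : ∀ x ∈ closedBall (0 : ℝ × ℝ) 1, sq (qs x) = x := by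
    intro x hx
    rw [mem_closedBall_zero_iff, Prod.norm_def] at hx
    exact Prod.ext (hcoe _ ((le_max_left _ _).trans hx)) (hcoe _ ((le_max_right _ _).trans hx))
  -- The null-homotopy is re-timed to `[-1, 1]` and reversed: it is constant at -1 and equals `W (·,
  -- 1)` at 1.
  let N : (ℝ × ℝ) × ℝ → A := fun p => L (projIcc 0 1 zero_le_one ((1 - p.2) / 2), qs p.1)
  have hN : Continuous N := L.continuous.comp
    ((continuous_projIcc.comp (by fun_prop)).prodMk (hqs.comp continuous_fst))
  have hN1 : ∀ x ∈ closedBall (0 : ℝ × ℝ) 1, N (x, 1) = W (x, 1) := by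
    intro x hx
    simp only [N, sub_self, zero_div, projIcc_left]
    rw [show (⟨0, _⟩ : Icc (0 : ℝ) 1) = 0 from rfl, ContinuousMap.HomotopyWith.apply_zero]
    change W (sq (qs x), 1) = _
    rw [hsqqs x hx]
  have hN2 : ∀ x, N (x, -1) = a := by
    intro x
    have : projIcc (0 : ℝ) 1 zero_le_one ((1 - (-1)) / 2) = 1 := by
      rw [projIcc_of_right_le _ (by norm_num)]
      rfl
    simp only [N, this]
    rw [ContinuousMap.HomotopyWith.apply_one]
    rfl
  have hN3 : ∀ x ∈ sphere (0 : ℝ × ℝ) 1, ∀ t, N (x, t) = a := by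
    intro x hx t
    have hb : qs x ∈ Cube.boundary (Fin 2) := by
      rw [hsqS, hsqqs x (sphere_subset_closedBall hx)]
      exact hx
    exact (L.eq_fst _ hb).trans (g.2 _ hb)
  -- transport the null-homotopy back along the contraction
  let G : ((ℝ × ℝ) × ℝ) × ℝ → A := fun p =>
    if p.2 = 0 then N p.1 else if p.1.2 = 1 then W (p.1.1, 1 - p.2) else u (p.2 • p.1.1)
  have hball : ∀ q : (ℝ × ℝ) × ℝ, q ∈ closedBall (0 : (ℝ × ℝ) × ℝ) 1 ↔
      q.1 ∈ closedBall (0 : ℝ × ℝ) 1 ∧ |q.2| ≤ 1 := by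
    intro q
    simp only [mem_closedBall_zero_iff, Prod.norm_def (x := q), sup_le_iff, Real.norm_eq_abs]
  have hG0 : ∀ q, G (q, 0) = N q := fun q => if_pos rfl
  have hG1 : ∀ x ∈ closedBall (0 : ℝ × ℝ) 1, ∀ s, G ((x, 1), s) = W (x, 1 - s) := by
    intro x hx s
    by_cases hs : s = 0
    · rw [hs, hG0, hN1 x hx, sub_zero]
    · simp [G, hs]
  have hG2 : ∀ x, ∀ s, G ((x, -1), s) = u (s • x) := by
    intro x s
    by_cases hs : s = 0
    · rw [hs, hG0, hN2 x, zero_smul]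
    · have : (-1 : ℝ) ≠ 1 := by norm_num
      simp [G, hs, this]
  have hG3 : ∀ x ∈ sphere (0 : ℝ × ℝ) 1, ∀ t, ∀ s ∈ Icc (0 : ℝ) 1, G ((x, t), s) = u (s • x) := by
    intro x hx t s hs'
    by_cases hs : s = 0
    · rw [hs, hG0, hN3 x hx, zero_smul]
    · by_cases ht : t = 1
      · rw [ht, hG1 x (sphere_subset_closedBall hx), hWs x hx _ (h1s s hs'), sub_sub_cancel]
      · simp [G, hs, ht]
  -- In the sup norm the unit sphere is the surface of a box. At `s = 1` the prescribed values are
  -- `w` on the lid, `u` on the floor and `u x` on the wall over `x`. The slice `s = 1` of the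
  -- extension is thus the desired homotopy, up to rescaling time.
  obtain ⟨K, hK, -, hKs, -⟩ := ball_homotopy_extension (a := 1) (E := (ℝ × ℝ) × ℝ) (X := A)
    (G := G) (by
      have hGa : ContinuousOn G (closedBall 0 1 ×ˢ {0}) :=
        (hN.comp continuous_fst).continuousOn.congr (by
          rintro ⟨q, s⟩ ⟨-, hs⟩
          obtain rfl : s = 0 := hs
          exact hG0 q)
      have hGb : ContinuousOn G ((closedBall 0 1 ×ˢ {1}) ×ˢ Icc 0 1) := by
        refine ContinuousOn.congr (f := fun p => W (p.1.1, 1 - p.2))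
          (hW.comp (by fun_prop) fun p hp => ⟨hp.1.1, h1s _ hp.2⟩) ?_
        rintro ⟨⟨x, t⟩, s⟩ ⟨⟨hx, ht⟩, -⟩
        obtain rfl : t = 1 := ht
        exact hG1 x hx s
      have hGc : ContinuousOn G
          ((closedBall 0 1 ×ˢ {-1} ∪ sphere 0 1 ×ˢ Icc (-1) 1) ×ˢ Icc 0 1) := by
        refine ContinuousOn.congr (f := fun p => u (p.2 • p.1.1))
          (hu.comp (by fun_prop) fun p hp => hsmul _ hp.2 _ ?_) ?_
        · rcases hp.1 with h | h
          · exact h.1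
          · exact sphere_subset_closedBall h.1
        · rintro ⟨⟨x, t⟩, s⟩ ⟨⟨hx, ht⟩ | ⟨hx, ht⟩, hs⟩
          · obtain rfl : t = -1 := ht
            exact hG2 x s
          · exact hG3 x hx t s hs
      refine (hGa.union_of_isClosed (hGb.union_of_isClosed hGc ?_ ?_) ?_ ?_).mono ?_
      · exact (isClosed_closedBall.prod isClosed_singleton).prod isClosed_Icc
      · exact ((isClosed_closedBall.prod isClosed_singleton).union
          (isClosed_sphere.prod isClosed_Icc)).prod isClosed_Icc
      · exact isClosed_closedBall.prod isClosed_singleton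
      · exact ((isClosed_closedBall.prod isClosed_singleton).prod isClosed_Icc).union
          (((isClosed_closedBall.prod isClosed_singleton).union
          (isClosed_sphere.prod isClosed_Icc)).prod isClosed_Icc)
      · rintro ⟨⟨x, t⟩, s⟩ (h | ⟨hq, hs⟩)
        · exact Or.inl h
        · right
          obtain ⟨hx, ht⟩ := (hball _).1 (sphere_subset_closedBall hq)
          rw [mem_sphere_zero_iff_norm, Prod.norm_def] at hq
          simp only at hx ht hq
          rcases max_choice ‖x‖ ‖t‖ with h' | h'
          · exact Or.inr ⟨Or.inr ⟨by rw [mem_sphere_zero_iff_norm, ← h', hq], abs_le.1 ht⟩, hs⟩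
          · rw [hq, eq_comm, Real.norm_eq_abs, abs_eq zero_le_one] at h'
            rcases h' with h' | h'
            · exact Or.inl ⟨⟨hx, h'⟩, hs⟩
            · exact Or.inr ⟨Or.inl ⟨hx, h'⟩, hs⟩)
  have hsph : ∀ x t, (x, t) ∈ sphere (0 : (ℝ × ℝ) × ℝ) 1 → K ((x, t), 1) = G ((x, t), 1) :=
    fun x t h => hKs _ h 1 (by simp)
  refine ⟨fun p => K ((p.1, 2 * p.2 - 1), 1), ?_, ?_, ?_, ?_⟩
  · refine hK.comp (by fun_prop) fun p hp => ⟨?_, by simp⟩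
    exact (hball _).2 ⟨hp.1, hI ⟨p.2, hp.2⟩⟩
  · intro x hx
    have hx' := mem_closedBall_zero_iff.1 hx
    simp only [mul_zero, zero_sub]
    rw [hsph, hG2, one_smul]
    rw [mem_sphere_zero_iff_norm, Prod.norm_def]
    simpa using hx'
  · intro x hx t ht
    have hx' := mem_sphere_zero_iff_norm.1 hx
    simp only
    rw [hsph, hG3 x hx _ 1 (by simp), one_smul]
    rw [mem_sphere_zero_iff_norm, Prod.norm_def]
    simp only [hx']
    exact max_eq_left (hI ⟨t, ht⟩)
  · intro x hx
    have hx' := mem_closedBall_zero_iff.1 hx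
    have e : (2 * 1 - 1 : ℝ) = 1 := by norm_num
    simp only [e]
    rw [hsph, hG1 x hx, sub_self, hW0 x hx]
    rw [mem_sphere_zero_iff_norm, Prod.norm_def]
    simpa using hx'

/-- Squares can be compressed inside `V` if `π₁(V \ Y) → π₁(V)` is injective and `π₂(V) = 0`. -/
theorem compresses_square {X : Type*} [TopologicalSpace X] {Y V : Set X}
    (h₂ : ∀ v : V, Subsingleton (HomotopyGroup.Pi 2 V v))
    (h₁ : ∀ v : ↥(V \ Y), Function.Injective
        (FundamentalGroup.map
          (⟨Set.inclusion Set.sdiff_subset, continuous_inclusion Set.sdiff_subset⟩ :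
            C(↥(V \ Y), V)) v)) :
    Compresses (ℝ × ℝ) Y V := by
  classical
  intro u hu huV huY
  have hb : ∀ t, squareLoop t ∈ closedBall (0 : ℝ × ℝ) 1 := fun t =>
    sphere_subset_closedBall (squareLoop_mem_sphere t)
  have hmem : ∀ t, u (squareLoop t) ∈ V \ Y := fun t =>
    ⟨huV (hb t), huY (squareLoop_mem_sphere t)⟩
  let a : ↥(V \ Y) := ⟨u (squareLoop 0), hmem 0⟩
  let γ : Path a a :=
    { toFun := fun t => ⟨u (squareLoop t), hmem t⟩
      continuous_toFun := by
        refine Continuous.subtype_mk ?_ _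
        exact hu.comp_continuous (continuous_squareLoop.comp continuous_subtype_val) fun t => hb t
      source' := by simp [a]
      target' := by simp [a, squareLoop_one] }
  let i : C(↥(V \ Y), V) := ⟨Set.inclusion Set.sdiff_subset, continuous_inclusion Set.sdiff_subset⟩
  let u' : ℝ × ℝ → V := fun z => if hz : z ∈ closedBall (0 : ℝ × ℝ) 1 then ⟨u z, huV hz⟩ else i a
  have hu'val : ∀ z ∈ closedBall (0 : ℝ × ℝ) 1, (u' z : X) = u z := fun z hz => by
    simp only [u', dif_pos hz]
  have hu' : ContinuousOn u' (closedBall 0 1) := by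
    rw [Topology.IsInducing.subtypeVal.continuousOn_iff]
    exact hu.congr hu'val
  -- The square `u` itself fills its boundary loop in `V`. Injectivity on π₁ gives another filling
  -- `w` in `V \ Y`, and π₂(V) = 0 makes the two homotopic relative to the boundary.
  have hnull : (γ.map i.continuous).Homotopic (Path.refl (i a)) :=
    homotopic_refl_of_filling hu' fun t => Subtype.ext (hu'val _ (hb t)).symm
  have hγ : γ.Homotopic (Path.refl a) := by
    refine Path.Homotopic.Quotient.exact (h₁ a
      (a₁ := FundamentalGroup.fromPath (Path.Homotopic.Quotient.mk γ))
      (a₂ := FundamentalGroup.fromPath (Path.Homotopic.Quotient.mk (Path.refl a))) ?_)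
    exact Path.Homotopic.Quotient.eq.2 hnull
  obtain ⟨w, hw, hwγ⟩ := exists_filling_of_homotopic_refl hγ
  obtain ⟨K, hK, hK0, hKs, hK1⟩ := exists_homotopy_of_pi_two_subsingleton h₂ hu'
    (i.continuous.comp_continuousOn hw) (by
      intro x hx
      obtain ⟨t, ht, h⟩ := exists_squareLoop_eq x
      rw [mem_sphere_zero_iff_norm.1 hx, one_smul] at h
      subst h
      refine Subtype.ext ?_
      rw [hu'val _ (hb t)]
      simp only [Function.comp_apply]
      rw [show squareLoop t = squareLoop (⟨t, ht⟩ : I) from rfl, hwγ]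
      rfl)
  refine ⟨fun p => K p, continuous_subtype_val.comp_continuousOn hK, fun p _ => (K p).2, ?_, ?_, ?_⟩
  · intro x hx
    simp only [hK0 x hx, hu'val x hx]
  · intro x hx t ht
    simp only [hKs x hx t ht, hu'val x (sphere_subset_closedBall hx)]
  · intro x hx
    simp only [hK1 x hx]
    exact (w x).2.2

end

/-! ### The weak topology and local contractibility of simplicial complexes. -/

section

open Set Metric Topology unitInterval

namespace AbstractSimplicialComplex

variable {ι : Type*} {K : AbstractSimplicialComplex ι}

/-- The standard simplex on the vertex set `s`, inside `ι → ℝ`. -/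
def stdFace (s : Finset ι) : Set (ι → ℝ) :=
  {a | (∀ i, 0 ≤ a i) ∧ (∀ i ∉ s, a i = 0) ∧ ∑ i ∈ s, a i = 1}

theorem mem_faces_of_subset {s t : Finset ι} (hs : s ∈ K.faces) (hts : t ⊆ s) (ht : t.Nonempty) :
    t ∈ K.faces :=
  K.isRelLowerSet_faces.mem_of_le hs hts ht

theorem nonempty_of_mem_faces {s : Finset ι} (hs : s ∈ K.faces) : s.Nonempty :=
  (K.isRelLowerSet_faces hs).1

namespace Realization

theorem nonneg (x : K.Realization) (i : ι) : 0 ≤ x.1 i := x.2.2.1 i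

theorem sum_eq_one (x : K.Realization) {s : Finset ι} (h : x.1.support ⊆ s) :
    ∑ i ∈ s, x.1 i = 1 := by
  exact (Finsupp.sum_of_support_subset _ h _ (fun _ _ => rfl)).symm.trans x.2.2.2

theorem coords_mem_stdFace (x : K.Realization) {s : Finset ι} (h : x.1.support ⊆ s) :
    (x.1 : ι → ℝ) ∈ stdFace s :=
  ⟨x.nonneg, fun _ hi => Finsupp.notMem_support_iff.1 fun hi' => hi (h hi'), x.sum_eq_one h⟩

open Classical in
/-- The point of the realization with given barycentric coordinates. -/
noncomputable def ofCoords {s : Finset ι} (hs : s ∈ K.faces) (a : stdFace s) : K.Realization :=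
  ⟨Finsupp.onFinset s a.1 fun i hi => by
      by_contra h
      exact hi (a.2.2.1 i h), by
    have hsub : (Finsupp.onFinset s a.1 fun i hi => by
      by_contra h
      exact hi (a.2.2.1 i h)).support ⊆ s := Finsupp.support_onFinset_subset
    refine ⟨mem_faces_of_subset hs hsub ?_, a.2.1, ?_⟩
    · by_contra h
      rw [Finset.not_nonempty_iff_eq_empty, Finsupp.support_eq_empty] at h
      have h1 := a.2.2.2
      exact zero_ne_one ((Finset.sum_eq_zero fun i _ => DFunLike.congr_fun h i).symm.trans h1)
    · rw [Finsupp.sum_of_support_subset _ hsub _ (fun _ _ => rfl)]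
      exact a.2.2.2⟩

@[simp]
theorem ofCoords_apply {s : Finset ι} (hs : s ∈ K.faces) (a : stdFace s) (i : ι) :
    (ofCoords hs a).1 i = a.1 i := rfl

theorem support_ofCoords_subset {s : Finset ι} (hs : s ∈ K.faces) (a : stdFace s) :
    (ofCoords hs a).1.support ⊆ s :=
  fun i hi => by
    by_contra h
    exact Finsupp.mem_support_iff.1 hi (a.2.2.1 i h)

@[ext]
theorem ext {x y : K.Realization} (h : ∀ i, x.1 i = y.1 i) : x = y :=
  Subtype.ext (Finsupp.ext h)

theorem ofCoords_coords {s : Finset ι} (hs : s ∈ K.faces) (x : K.Realization)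
    (h : x.1.support ⊆ s) : ofCoords hs ⟨x.1, x.coords_mem_stdFace h⟩ = x :=
  ext fun _ => rfl

/-- Lets the weak topology be tested along parametrizations by concrete coordinate vectors, in place
of subsets of the realization. -/
theorem isOpen_iff {U : Set K.Realization} :
    IsOpen U ↔ ∀ s, ∀ hs : s ∈ K.faces, IsOpen (ofCoords hs ⁻¹' U) := by
  rw [isOpen_iSup_iff, Subtype.forall]
  refine forall₂_congr fun s hs => ?_
  rw [isOpen_coinduced, isOpen_induced_iff, isOpen_induced_iff]
  refine exists_congr fun V => and_congr_right fun _ => ?_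
  constructor
  · intro h
    ext a
    exact (Set.ext_iff.1 h ⟨ofCoords hs a, support_ofCoords_subset hs a⟩)
  · intro h
    ext ⟨x, hx⟩
    have := (Set.ext_iff.1 h ⟨x.1, x.coords_mem_stdFace hx⟩)
    rw [mem_preimage (f := ofCoords hs), ofCoords_coords hs x hx] at this
    exact this

theorem isClosed_iff {U : Set K.Realization} :
    IsClosed U ↔ ∀ s, ∀ hs : s ∈ K.faces, IsClosed (ofCoords hs ⁻¹' U) := by
  simp only [← isOpen_compl_iff, isOpen_iff, preimage_compl]

theorem continuous_ofCoords {s : Finset ι} (hs : s ∈ K.faces) :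
    Continuous (ofCoords hs) :=
  ⟨fun _ hU => isOpen_iff.1 hU s hs⟩

theorem continuous_iff {Z : Type*} [TopologicalSpace Z] {g : K.Realization → Z} :
    Continuous g ↔ ∀ s, ∀ hs : s ∈ K.faces, Continuous (g ∘ ofCoords hs) := by
  refine ⟨fun h s hs => h.comp (continuous_ofCoords hs), fun h => ⟨fun U hU => ?_⟩⟩
  exact isOpen_iff.2 fun s hs => hU.preimage (h s hs)

theorem continuous_coord (i : ι) : Continuous fun x : K.Realization => x.1 i :=
  continuous_iff.2 fun _ _ => (continuous_apply i).comp continuous_subtype_val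

theorem continuous_of_coords {A : Type*} [TopologicalSpace A] {g : A → K.Realization}
    {s : Finset ι} (hs : s ∈ K.faces) (hg : ∀ a, (g a).1.support ⊆ s)
    (hc : ∀ i ∈ s, Continuous fun a => (g a).1 i) : Continuous g := by
  have h1 : Continuous fun a => (⟨(g a).1, (g a).coords_mem_stdFace (hg a)⟩ : stdFace s) := by
    refine Continuous.subtype_mk (continuous_pi fun i => ?_) _
    by_cases hi : i ∈ s
    · exact hc i hi
    · have : (fun a => (g a).1 i) = fun _ => 0 := by
        ext a
        exact Finsupp.notMem_support_iff.1 fun hi' => hi (hg a hi')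
      rw [this]
      exact continuous_const
  exact ((continuous_ofCoords hs).comp h1).congr fun a => ofCoords_coords hs _ (hg a)

/-- A quotient map stays one after multiplication with the locally compact interval. Joint
continuity of a homotopy can thus be checked on each simplex, without local finiteness. -/
theorem isQuotientMap_ofCoords :
    IsQuotientMap fun p : (Σ s : K.faces, stdFace s.1) => ofCoords p.1.2 p.2 := by
  refine isQuotientMap_iff_isClosed.2 ⟨fun x => ?_, fun U => ?_⟩
  · exact ⟨⟨⟨x.1.support, x.2.1⟩, ⟨x.1, x.coords_mem_stdFace subset_rfl⟩⟩,
      ofCoords_coords _ _ subset_rfl⟩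
  · rw [isClosed_iff, isClosed_sigma_iff, Subtype.forall]
    rfl

/-- Even for infinite `F`, the union cuts a given simplex in a finite union of its faces. -/
theorem isClosed_biUnion_simplex (F : Set (Finset ι)) : IsClosed (⋃ s ∈ F, simplex K s) := by
  classical
  refine isClosed_iff.2 fun r hr => ?_
  have : ofCoords hr ⁻¹' (⋃ s ∈ F, simplex K s) =
      ⋃ q ∈ {q : Finset ι | q ∈ r.powerset ∧ ∃ s ∈ F, q ⊆ s}, {a : stdFace r | ∀ i, i ∉ q → a.1 i = 0} := by
    ext a
    simp only [mem_preimage, mem_iUnion₂, simplex, mem_ofPred_eq]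
    constructor
    · rintro ⟨s, hs, h⟩
      exact ⟨_, by
        refine ⟨Finset.mem_powerset.2 (support_ofCoords_subset hr a), s, hs, h⟩,
        fun i hi => Finsupp.notMem_support_iff (f := (ofCoords hr a).1).1 hi⟩
    · rintro ⟨q, ⟨-, s, hs, hqs⟩, h⟩
      refine ⟨s, hs, fun i hi => hqs ?_⟩
      by_contra hiq
      exact Finsupp.mem_support_iff.1 hi (h i hiq)
  rw [this]
  refine Set.Finite.isClosed_biUnion (r.powerset.finite_toSet.subset fun q hq => hq.1) fun q _ => ?_
  simp only [ofPred_forall]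
  exact isClosed_iInter fun i => isClosed_iInter fun _ =>
    isClosed_singleton.preimage ((continuous_apply i).comp continuous_subtype_val)

/-- A cut-off function which is `1` near `x` and vanishes outside the open star of `x`. -/
noncomputable def bump (x p : K.Realization) : ℝ := ∏ i ∈ x.1.support, min 1 (2 * p.1 i / x.1 i)

theorem bump_nonneg (x p : K.Realization) : 0 ≤ bump x p :=
  Finset.prod_nonneg fun i _ => le_min zero_le_one
    (div_nonneg (mul_nonneg zero_le_two (p.nonneg i)) (x.nonneg i))

theorem bump_le_one (x p : K.Realization) : bump x p ≤ 1 :=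
  Finset.prod_le_one (fun i _ => le_min zero_le_one
    (div_nonneg (mul_nonneg zero_le_two (p.nonneg i)) (x.nonneg i))) fun _ _ => min_le_left _ _

theorem bump_eq_zero {x p : K.Realization} {i : ι} (hx : x.1 i ≠ 0) (hp : p.1 i = 0) :
    bump x p = 0 :=
  Finset.prod_eq_zero (Finsupp.mem_support_iff.2 hx) (by simp [hp])

theorem continuous_bump (x : K.Realization) : Continuous (bump x) := by
  refine continuous_finsetProd _ fun i _ => ?_
  have := continuous_coord (K := K) i
  fun_prop

/-- The straight-line contraction of a neighbourhood of `x` to `x`, cut off by `bump x`. -/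
noncomputable def contract (x p : K.Realization) (t : I) : K.Realization :=
  ⟨(1 - t * bump x p) • p.1 + (t * bump x p : ℝ) • x.1, by
    have hb0 := bump_nonneg x p
    have hb1 := bump_le_one x p
    have hc0 : 0 ≤ t * bump x p := mul_nonneg t.2.1 hb0
    have hc1 : t * bump x p ≤ 1 := mul_le_one₀ t.2.2 hb0 hb1
    set q : ι →₀ ℝ := (1 - t * bump x p) • p.1 + (t * bump x p : ℝ) • x.1 with hq
    have hqi : ∀ i, q i = (1 - t * bump x p) * p.1 i + t * bump x p * x.1 i := fun i => rfl
    have hsub : q.support ⊆ p.1.support := by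
      intro i hi
      rw [Finsupp.mem_support_iff] at hi ⊢
      intro hp
      refine hi ?_
      rw [hqi, hp]
      by_cases hx : x.1 i = 0
      · simp [hx]
      · simp [bump_eq_zero hx hp]
    have hsum : ∑ i ∈ p.1.support, q i = 1 := by
      simp only [hqi, Finset.sum_add_distrib, ← Finset.mul_sum]
      rw [p.sum_eq_one subset_rfl]
      by_cases hb : bump x p = 0
      · simp [hb]
      · rw [x.sum_eq_one (fun i hi => ?_)]
        · ring
        · by_contra hp
          exact hb (bump_eq_zero (Finsupp.mem_support_iff.1 hi) (Finsupp.notMem_support_iff.1 hp))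
    refine ⟨mem_faces_of_subset p.2.1 hsub ?_, fun i => ?_, ?_⟩
    · by_contra h
      rw [Finset.not_nonempty_iff_eq_empty, Finsupp.support_eq_empty] at h
      rw [h] at hsum
      simp at hsum
    · rw [hqi]
      exact add_nonneg (mul_nonneg (by linarith) (p.nonneg i)) (mul_nonneg hc0 (x.nonneg i))
    · rw [Finsupp.sum_of_support_subset _ hsub _ (fun _ _ => rfl)]
      exact hsum⟩

theorem contract_apply (x p : K.Realization) (t : I) (i : ι) :
    (contract x p t).1 i = (1 - t * bump x p) * p.1 i + t * bump x p * x.1 i := rfl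

/-- The cut-off vanishes unless `p` has all vertices of `x` in its support, so the motion towards
`x` never leaves the closed simplex of `p`. This is what allows continuity to be checked simplex by
simplex. -/
theorem support_contract_subset (x p : K.Realization) (t : I) :
    (contract x p t).1.support ⊆ p.1.support := by
  intro i hi
  rw [Finsupp.mem_support_iff] at hi ⊢
  intro hp
  refine hi ?_
  rw [contract_apply, hp]
  by_cases hx : x.1 i = 0
  · simp [hx]
  · simp [bump_eq_zero hx hp]

theorem continuous_contract (x : K.Realization) :
    Continuous fun p : K.Realization × I => contract x p.1 p.2 := by
  refine (isQuotientMap_ofCoords (K := K)).continuous_lift_prod_left ?_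
  rw [← Homeomorph.sigmaProdDistrib.symm.comp_continuous_iff']
  refine continuous_sigma fun s => ?_
  refine continuous_of_coords s.2
    (fun p => (support_contract_subset _ _ _).trans (support_ofCoords_subset s.2 p.1)) fun i _ => ?_
  have h1 : Continuous fun p : stdFace s.1 × I => bump x (ofCoords s.2 p.1) :=
    (continuous_bump x).comp ((continuous_ofCoords s.2).comp continuous_fst)
  have h2 : Continuous fun p : stdFace s.1 × I => p.1.1 i :=
    (continuous_apply i).comp (continuous_subtype_val.comp continuous_fst)
  change Continuous fun p : stdFace s.1 × I => (1 - (p.2 : ℝ) * bump x (ofCoords s.2 p.1)) * p.1.1 i +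
    (p.2 : ℝ) * bump x (ofCoords s.2 p.1) * x.1 i
  fun_prop

/-- Where every coordinate in the support of `x` exceeds half its value at `x`, all factors of the
cut-off are 1 and time 1 lands on `x`. The homotopy need not preserve this open set. -/
theorem exists_contraction (x : K.Realization) :
    ∃ H : K.Realization × I → K.Realization, Continuous H ∧ (∀ p, H (p, 0) = p) ∧
      (∀ t, H (x, t) = x) ∧ ∃ O, IsOpen O ∧ x ∈ O ∧ ∀ p ∈ O, H (p, 1) = x := by
  refine ⟨fun p => contract x p.1 p.2, continuous_contract x, fun p => ?_, fun t => ?_,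
    {p | ∀ i ∈ x.1.support, x.1 i / 2 < p.1 i}, ?_, ?_, fun p hp => ?_⟩
  · ext i
    simp [contract_apply]
  · ext i
    simp only [contract_apply]
    ring
  · simp only [ofPred_forall]
    exact isOpen_biInter_finset fun i _ => isOpen_lt continuous_const (continuous_coord i)
  · intro i hi
    have : 0 < x.1 i := (x.nonneg i).lt_of_ne' (Finsupp.mem_support_iff.1 hi)
    linarith
  · have hb : bump x p = 1 := by
      refine Finset.prod_eq_one fun i hi => min_eq_left ?_
      have : 0 < x.1 i := (x.nonneg i).lt_of_ne' (Finsupp.mem_support_iff.1 hi)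
      rw [le_div_iff₀ this]
      linarith [hp i hi]
    ext i
    simp [contract_apply, hb]

end Realization

end AbstractSimplicialComplex

open AbstractSimplicialComplex

namespace Triangulation

variable {ι Z : Type*} [TopologicalSpace Z]

theorem IsSubcomplex.isClosed {T : Triangulation ι Z} {A : Set Z} (hA : T.IsSubcomplex A) :
    IsClosed A := by
  obtain ⟨F, -, rfl⟩ := hA
  have := (Realization.isClosed_biUnion_simplex (K := T.complex) F).preimage
    T.homeo.symm.continuous
  rw [preimage_iUnion₂] at this
  exact this

/-- Triangulated spaces are locally contractible. -/
theorem exists_contractible_nhd (T : Triangulation ι Z) (x : Z) {U : Set Z} (hU : IsOpen U)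
    (hx : x ∈ U) : ∃ W, IsOpen W ∧ x ∈ W ∧ ∃ hWU : W ⊆ U,
      Nonempty (ContinuousMap.Homotopy (⟨inclusion hWU, continuous_inclusion hWU⟩ : C(W, U))
        (ContinuousMap.const W ⟨x, hx⟩)) := by
  obtain ⟨H, hH, hH0, hHx, O, hO, hxO, hO1⟩ := Realization.exists_contraction (T.homeo.symm x)
  let H' : I × Z → Z := fun q => T.homeo (H (T.homeo.symm q.2, q.1))
  have hH' : Continuous H' := by
    have := T.homeo.continuous
    have := T.homeo.symm.continuous
    fun_prop
  have h0 : ∀ p, H' (0, p) = p := fun p => by simp [H', hH0]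
  have h1 : ∀ p ∈ T.homeo.symm ⁻¹' O, H' (1, p) = x := fun p hp => by simp [H', hO1 _ hp]
  have h2 : ∀ t, H' (t, x) = x := fun t => by simp [H', hHx]
  -- The track of `x` is constant, so by compactness of the interval the tracks of all nearby points
  -- stay in `U`.
  obtain ⟨A, W, -, hW, hA, hxW, hAW⟩ := generalized_tube_lemma (s := (univ : Set I)) isCompact_univ
    (t := {x}) isCompact_singleton (n := H' ⁻¹' U) (hU.preimage hH') (by
      rintro ⟨t, y⟩ ⟨-, hy⟩
      obtain rfl : y = x := hy
      rw [mem_preimage, h2]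
      exact hx)
  have key : ∀ p ∈ W, ∀ t, H' (t, p) ∈ U := fun p hp t => hAW ⟨hA trivial, hp⟩
  have hsub : W ⊆ U := fun p hp => h0 p ▸ key p hp 0
  refine ⟨W ∩ T.homeo.symm ⁻¹' O, hW.inter (hO.preimage T.homeo.symm.continuous),
    ⟨hxW rfl, hxO⟩, inter_subset_left.trans hsub, ⟨⟨⟨fun q => ⟨H' (q.1, q.2), key _ q.2.2.1 _⟩,
      by fun_prop⟩, fun p => Subtype.ext (h0 p), fun p => Subtype.ext (h1 p p.2.2)⟩⟩⟩

end Triangulation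

end

/-! ### Pushing points and paths off `Y`. -/

section

open Set Metric Topology unitInterval

section PathLifting

variable {A : Type*} [TopologicalSpace A]

/-- A path class which is represented by a path inside `D`. -/
def Path.Homotopic.Quotient.RepresentedIn (D : Set A) {a b : A}
    (q : Path.Homotopic.Quotient a b) : Prop :=
  ∃ p : Path a b, (∀ t, p t ∈ D) ∧ Path.Homotopic.Quotient.mk p = q

namespace Path.Homotopic.Quotient.RepresentedIn

variable {D : Set A} {a b c : A} {p : Path.Homotopic.Quotient a b} {q : Path.Homotopic.Quotient b c}

theorem trans (hp : p.RepresentedIn D) (hq : q.RepresentedIn D) :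
    (p.trans q).RepresentedIn D := by
  obtain ⟨p, hp, rfl⟩ := hp
  obtain ⟨q, hq, rfl⟩ := hq
  refine ⟨p.trans q, fun t => ?_, rfl⟩
  have : p.trans q t ∈ range (p.trans q) := mem_range_self t
  rw [Path.trans_range] at this
  rcases this with ⟨s, hs⟩ | ⟨s, hs⟩ <;> rw [← hs]
  exacts [hp s, hq s]

end Path.Homotopic.Quotient.RepresentedIn

/-- If `D` is open, locally accessible by paths and locally surjective on path classes, then every
path with endpoints in `D` is homotopic to a path in `D`. -/
theorem exists_homotopic_path_in {D : Set A} (hD : IsOpen D)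
    (hacc : ∀ x, ∀ U, IsOpen U → x ∈ U → ∃ z ∈ D, JoinedIn U x z)
    (hloc : ∀ x, ∃ W, IsOpen W ∧ x ∈ W ∧ ∀ a ∈ D, ∀ b ∈ D, ∀ γ : Path a b, (∀ t, γ t ∈ W) →
      ∃ γ' : Path a b, (∀ t, γ' t ∈ D) ∧ γ.Homotopic γ')
    {a b : A} (ha : a ∈ D) (hb : b ∈ D) (γ : Path a b) :
    ∃ γ' : Path a b, (∀ t, γ' t ∈ D) ∧ γ.Homotopic γ' := by
  choose W hW hxW hloc using hloc
  obtain ⟨t, ht0, htm, ⟨n, hn⟩, htc⟩ := exists_monotone_Icc_subset_open_cover_unitInterval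
    (c := fun x => γ ⁻¹' W x) (fun x => (hW x).preimage γ.continuous)
    (fun s _ => mem_iUnion.2 ⟨γ s, hxW _⟩)
  -- The initial piece of `γ`, followed by a short detour `δ` into `D`, is homotopic to a path in
  -- `D`. The detour must fit in an arbitrary `U`, since the next step needs it inside the set `W x`
  -- covering the next piece.
  have key : ∀ k, ∀ U, IsOpen U → γ (t k) ∈ U → ∃ z ∈ D, ∃ δ : Path (γ (t k)) z,
      (∀ s, δ s ∈ U) ∧
      ((Path.Homotopic.Quotient.mk (γ.subpath (t 0) (t k))).trans (Path.Homotopic.Quotient.mk δ)).RepresentedIn D := by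
    intro k
    induction k with
    | zero =>
      intro U _ hU
      refine ⟨γ (t 0), ?_, Path.refl _, fun _ => hU, Path.refl _, fun s => ?_, ?_⟩
      · rw [ht0, γ.source]; exact ha
      · rw [Path.refl_apply, ht0, γ.source]; exact ha
      · rw [Path.subpath_self, Path.Homotopic.Quotient.mk_refl, Path.Homotopic.Quotient.trans_refl]
    | succ k ih =>
      intro U hU hkU
      obtain ⟨x, hx⟩ := htc k
      have hk : t k ≤ t (k + 1) := htm k.le_succ
      obtain ⟨z', hz', hj⟩ := hacc (γ (t (k + 1))) (U ∩ W x) (hU.inter (hW x))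
        ⟨hkU, hx (right_mem_Icc.2 hk)⟩
      let δ' := hj.somePath
      have hδ' : ∀ s, δ' s ∈ U ∩ W x := hj.somePath_mem
      obtain ⟨z, hz, δ, hδ, hgood⟩ := ih (W x) (hW x) (hx (left_mem_Icc.2 hk))
      have hsub : ∀ s, γ.subpath (t k) (t (k + 1)) s ∈ W x := by
        intro s
        have : γ.subpath (t k) (t (k + 1)) s ∈ range (γ.subpath (t k) (t (k + 1))) :=
          mem_range_self s
        rw [Path.range_subpath_of_le _ _ _ hk] at this
        obtain ⟨r, hr, h⟩ := this
        rw [← h]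
        exact hx hr
      -- Back along the old detour, along the next piece, out along the new detour: this path lies
      -- in `W x` and has its endpoints in `D`.
      obtain ⟨ρ, hρ, hρh⟩ := hloc x z hz z' hz'
        (δ.symm.trans ((γ.subpath (t k) (t (k + 1))).trans δ')) (by
          intro s
          have := mem_range_self (f := δ.symm.trans ((γ.subpath (t k) (t (k + 1))).trans δ')) s
          rw [Path.trans_range, Path.trans_range, Path.symm_range] at this
          rcases this with ⟨r, hr⟩ | ⟨r, hr⟩ | ⟨r, hr⟩ <;> rw [← hr]
          exacts [hδ r, hsub r, (hδ' r).2])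
      refine ⟨z', hz', δ', fun s => (hδ' s).1, ?_⟩
      have h1 := hgood.trans (q := Path.Homotopic.Quotient.mk ρ) ⟨ρ, hρ, rfl⟩
      have h2 : Path.Homotopic.Quotient.mk (γ.subpath (t 0) (t (k + 1))) =
          (Path.Homotopic.Quotient.mk (γ.subpath (t 0) (t k))).trans
            (Path.Homotopic.Quotient.mk (γ.subpath (t k) (t (k + 1)))) :=
        (Path.Homotopic.Quotient.eq.2 ⟨Path.Homotopy.subpathTransSubpath γ _ _ _⟩).symm
      rw [← Path.Homotopic.Quotient.eq.2 hρh] at h1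
      simp only [Path.Homotopic.Quotient.mk_trans, Path.Homotopic.Quotient.mk_symm] at h1
      rw [h2]
      convert h1 using 1
      simp only [Path.Homotopic.Quotient.trans_assoc]
      rw [← Path.Homotopic.Quotient.trans_assoc (Path.Homotopic.Quotient.mk δ),
        Path.Homotopic.Quotient.trans_symm, Path.Homotopic.Quotient.refl_trans]
  have hn1 : t n = 1 := hn n le_rfl
  have hend : ∀ x y : I, x = 0 → y = 1 → (∀ U, IsOpen U → γ y ∈ U → ∃ z ∈ D, ∃ δ : Path (γ y) z,
      (∀ s, δ s ∈ U) ∧ ((Path.Homotopic.Quotient.mk (γ.subpath x y)).trans (Path.Homotopic.Quotient.mk δ)).RepresentedIn D) →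
      ∃ γ' : Path a b, (∀ t, γ' t ∈ D) ∧ γ.Homotopic γ' := by
    rintro _ _ rfl rfl h
    -- With `U = D` the last detour stays in `D`, so it can be undone there.
    obtain ⟨z, hz, δ, hδ, hgood⟩ := h D hD (by rw [γ.target]; exact hb)
    have h3 := hgood.trans (q := (Path.Homotopic.Quotient.mk δ).symm) ⟨δ.symm, fun s => hδ _, rfl⟩
    rw [Path.Homotopic.Quotient.trans_assoc, Path.Homotopic.Quotient.trans_symm, Path.Homotopic.Quotient.trans_refl, Path.subpath_zero_one] at h3
    obtain ⟨ρ, hρ, hρh⟩ := h3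
    exact ⟨ρ.cast γ.source.symm γ.target.symm, hρ,
      ((Path.Homotopic.Quotient.exact hρh).symm.pathCast γ.source.symm γ.target.symm)⟩
  exact hend _ _ ht0 hn1 (key n)

/-- Paths with the same endpoints in a subset which contracts inside `A` are homotopic in `A`. -/
theorem Path.Homotopic.of_homotopy_const {B : Type*} [TopologicalSpace B] {f : C(B, A)} {x : A}
    (H : f.Homotopy (ContinuousMap.const B x)) {a b : B} (γ γ' : Path a b) :
    (γ.map f.continuous).Homotopic (γ'.map f.continuous) := by
  -- Naturality of the tracks of `H`: the image of the path followed by the track of `b` is the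
  -- track of `a` followed by a constant path. The right side is the same for both paths, and the
  -- track of `b` cancels.
  have h := Path.Homotopic.Quotient.eq.2 (Path.Homotopic.map_trans_evalAt H γ)
  have h' := Path.Homotopic.Quotient.eq.2 (Path.Homotopic.map_trans_evalAt H γ')
  have hc : γ.map (ContinuousMap.const B x).continuous =
      γ'.map (ContinuousMap.const B x).continuous := rfl
  rw [hc, ← h', Path.Homotopic.Quotient.mk_trans, Path.Homotopic.Quotient.mk_trans] at h
  have h2 := congrArg (fun q => q.trans (Path.Homotopic.Quotient.mk (H.evalAt b)).symm) h
  simp only [Path.Homotopic.Quotient.trans_assoc, Path.Homotopic.Quotient.trans_symm,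
    Path.Homotopic.Quotient.trans_refl] at h2
  exact Path.Homotopic.Quotient.exact h2

end PathLifting

/-- Every open neighbourhood of a point contains a smaller one which contracts to the point inside
the larger one. -/
def LocallyContractible (X : Type*) [TopologicalSpace X] : Prop :=
  ∀ x : X, ∀ U : Set X, IsOpen U → ∀ hx : x ∈ U, ∃ W, IsOpen W ∧ x ∈ W ∧ ∃ hWU : W ⊆ U,
      Nonempty (ContinuousMap.Homotopy (⟨inclusion hWU, continuous_inclusion hWU⟩ : C(W, U))
        (ContinuousMap.const W ⟨x, hx⟩))

section Compression

variable {X : Type*} [TopologicalSpace X] {Y : Set X}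

/-- Density provides a point off `Y` in the set that contracts to `x`; its track under the
contraction is the path. -/
theorem LocallyContractible.exists_joinedIn (hX : LocallyContractible X) (h₁ : Dense Yᶜ)
    {x : X} {U : Set X} (hU : IsOpen U) (hx : x ∈ U) : ∃ z ∈ Yᶜ, JoinedIn U x z := by
  obtain ⟨W, hW, hxW, hWU, ⟨H⟩⟩ := hX x U hU hx
  obtain ⟨z, hzW, hz⟩ := h₁.inter_open_nonempty W hW ⟨x, hxW⟩
  refine ⟨z, hz, JoinedIn.symm ⟨((H.evalAt ⟨z, hzW⟩).map continuous_subtype_val).cast rfl rfl,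
    fun t => ?_⟩⟩
  exact (H (t, ⟨z, hzW⟩)).2

theorem joinedIn_subtype {U V : Set X} (hUV : U ⊆ V) {x y : X} (hj : JoinedIn U x y) :
    JoinedIn ((↑) ⁻¹' U : Set V) ⟨x, hUV hj.source_mem⟩ ⟨y, hUV hj.target_mem⟩ := by
  refine ⟨⟨⟨fun t => ⟨hj.somePath t, hUV (hj.somePath_mem t)⟩, by fun_prop⟩, ?_, ?_⟩, fun t => ?_⟩
  · exact Subtype.ext hj.somePath.source
  · exact Subtype.ext hj.somePath.target
  · exact hj.somePath_mem t

/-- Near a point of `Y`, a set `W` contracting inside `V` contains a `V'` with `V' \ Y` path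
connected. A path in `V'` with ends off `Y` is replaced by one in `V' \ Y`, and the contraction
makes them homotopic in `V`. Near other points nothing needs to change, since `Y` is closed.
Subdivision does the rest. -/
theorem LocallyContractible.exists_path_off (hX : LocallyContractible X) (hY : IsClosed Y)
    (h₁ : Dense Yᶜ)
    (h₂ : ∀ y ∈ Y, ∀ U : Set X, IsOpen U → y ∈ U →
      ∃ V ⊆ U, IsOpen V ∧ y ∈ V ∧ IsPathConnected (V \ Y))
    {V : Set X} (hV : IsOpen V) {a b : V} (ha : (a : X) ∉ Y) (hb : (b : X) ∉ Y) (γ : Path a b) :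
    ∃ γ' : Path a b, (∀ t, (γ' t : X) ∉ Y) ∧ γ.Homotopic γ' := by
  refine exists_homotopic_path_in (D := (↑) ⁻¹' Yᶜ)
    (hY.isOpen_compl.preimage continuous_subtype_val) ?_ ?_ ha hb γ
  · rintro ⟨x, hx⟩ U hU hxU
    obtain ⟨U', hU', rfl⟩ := isOpen_induced_iff.1 hU
    obtain ⟨z, hz, hj⟩ := hX.exists_joinedIn h₁ (hU'.inter hV) ⟨hxU, hx⟩
    refine ⟨⟨z, hj.target_mem.2⟩, hz, (joinedIn_subtype inter_subset_right hj).mono ?_⟩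
    exact fun p hp => hp.1
  · rintro ⟨x, hx⟩
    by_cases hxY : x ∈ Y
    · obtain ⟨W, hW, hxW, hWV, ⟨H⟩⟩ := hX x V hV hx
      obtain ⟨V', hV'W, hV', hxV', hpc⟩ := h₂ x hxY W hW hxW
      refine ⟨(Subtype.val ⁻¹' V' : Set V), hV'.preimage continuous_subtype_val, hxV', ?_⟩
      rintro ⟨a, haV⟩ ha ⟨b, hbV⟩ hb γ hγ
      have haV' : a ∈ V' := by simpa using hγ 0
      have hbV' : b ∈ V' := by simpa using hγ 1
      have hj := hpc.joinedIn a ⟨haV', ha⟩ b ⟨hbV', hb⟩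
      have hjm := hj.somePath_mem
      let γ₀ : Path (⟨a, hV'W haV'⟩ : W) ⟨b, hV'W hbV'⟩ :=
        ⟨⟨fun t => ⟨γ t, hV'W (hγ t)⟩, by fun_prop⟩, Subtype.ext (by simp), Subtype.ext (by simp)⟩
      let γ₁ : Path (⟨a, hV'W haV'⟩ : W) ⟨b, hV'W hbV'⟩ :=
        ⟨⟨fun t => ⟨hj.somePath t, hV'W (hjm t).1⟩, by fun_prop⟩,
          Subtype.ext (by simp), Subtype.ext (by simp)⟩
      exact ⟨γ₁.map (continuous_inclusion hWV), fun t => (hjm t).2,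
        Path.Homotopic.of_homotopy_const H γ₀ γ₁⟩
    · exact ⟨(Subtype.val ⁻¹' Yᶜ : Set V), hY.isOpen_compl.preimage continuous_subtype_val, hxY,
        fun a _ b _ γ hγ => ⟨γ, hγ, .refl γ⟩⟩

theorem LocallyContractible.compresses_interval (hX : LocallyContractible X) (hY : IsClosed Y)
    (h₁ : Dense Yᶜ)
    (h₂ : ∀ y ∈ Y, ∀ U : Set X, IsOpen U → y ∈ U →
      ∃ V ⊆ U, IsOpen V ∧ y ∈ V ∧ IsPathConnected (V \ Y))
    {V : Set X} (hV : IsOpen V) : Compresses ℝ Y V := by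
  intro u hu huV huY
  have hI : ∀ t : I, 2 * (t : ℝ) - 1 ∈ closedBall (0 : ℝ) 1 := fun t => by
    rw [mem_closedBall_zero_iff, Real.norm_eq_abs]
    exact abs_le.2 ⟨by linarith [t.2.1], by linarith [t.2.2]⟩
  let γ : Path (⟨u (-1), huV (by simp)⟩ : V) ⟨u 1, huV (by simp)⟩ :=
    ⟨⟨fun t => ⟨u (2 * t - 1), huV (hI t)⟩,
      (hu.comp_continuous (by fun_prop) hI).subtype_mk _⟩, Subtype.ext (by simp),
      Subtype.ext (by norm_num)⟩
  obtain ⟨γ', hγ', ⟨F⟩⟩ := hX.exists_path_off hY h₁ h₂ hV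
    (a := ⟨u (-1), _⟩) (b := ⟨u 1, _⟩)
    (huY (by simp : (-1 : ℝ) ∈ sphere (0 : ℝ) 1)) (huY (by simp : (1 : ℝ) ∈ sphere (0 : ℝ) 1)) γ
  have hcoe : ∀ r ∈ closedBall (0 : ℝ) 1,
      2 * (projIcc 0 1 zero_le_one ((1 + r) / 2) : ℝ) - 1 = r := by
    intro r hr
    rw [mem_closedBall_zero_iff, Real.norm_eq_abs, abs_le] at hr
    rw [coe_projIcc, min_eq_right (by linarith), max_eq_right (by linarith)]
    ring
  have hproj : Continuous (projIcc (0 : ℝ) 1 zero_le_one) := continuous_projIcc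
  refine ⟨fun p => F (projIcc 0 1 zero_le_one p.2, projIcc 0 1 zero_le_one ((1 + p.1) / 2)), ?_,
    fun p _ => (F _).2, ?_, ?_, ?_⟩
  · refine Continuous.continuousOn ?_
    fun_prop
  · intro x hx
    simp only [projIcc_left]
    rw [show (⟨0, _⟩ : Icc (0 : ℝ) 1) = 0 from rfl, ContinuousMap.HomotopyWith.apply_zero]
    exact congrArg u (hcoe x hx)
  · intro x hx t _
    rw [mem_sphere_zero_iff_norm, Real.norm_eq_abs, abs_eq zero_le_one] at hx
    rcases hx with rfl | rfl
    · have : projIcc (0 : ℝ) 1 zero_le_one ((1 + 1) / 2) = 1 := by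
        rw [projIcc_of_right_le _ (by norm_num)]; rfl
      simp only [this, Path.Homotopy.target]
    · have : projIcc (0 : ℝ) 1 zero_le_one ((1 + -1) / 2) = 0 := by
        rw [projIcc_of_le_left _ (by norm_num)]; rfl
      simp only [this, Path.Homotopy.source]
  · intro x _
    simp only [projIcc_right]
    rw [show (⟨1, _⟩ : Icc (0 : ℝ) 1) = 1 from rfl, ContinuousMap.HomotopyWith.apply_one]
    exact hγ' _

/-- The unit sphere of the zero space is empty, so the point may move freely. -/
theorem LocallyContractible.compresses_point (hX : LocallyContractible X) (h₁ : Dense Yᶜ)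
    {V : Set X} (hV : IsOpen V) : Compresses PUnit.{1} Y V := by
  intro u _ huV _
  obtain ⟨z, hz, hj⟩ := hX.exists_joinedIn h₁ hV
    (huV (mem_closedBall_self zero_le_one : (0 : PUnit) ∈ closedBall 0 1))
  have hproj : Continuous (projIcc (0 : ℝ) 1 zero_le_one) := continuous_projIcc
  refine ⟨fun p => hj.somePath (projIcc 0 1 zero_le_one p.2), ?_, fun p _ => hj.somePath_mem _,
    ?_, ?_, ?_⟩
  · refine Continuous.continuousOn ?_
    fun_prop
  · intro x _
    simp only [projIcc_left]
    exact hj.somePath.source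
  · intro x hx
    simp at hx
  · intro x _
    simp only [projIcc_right]
    exact (congrArg (· ∉ Y) hj.somePath.target).mpr hz

end Compression

end

/-! ### Subdividing a square into a grid. -/

section

open Set Metric Topology unitInterval

/-- The cells of the half-line `[0, ∞)` subdivided at the natural numbers: the vertex `j` for
`k = 2 * j` and the edge `[j, j + 1]` for `k = 2 * j + 1`. -/
def lineCell (k : ℕ) : Set ℝ := {x | |2 * x - k| ≤ (k % 2 : ℕ)}

/-- The incidence relation of the cells `lineCell`. -/
def LineFace (b c : ℕ) : Prop := b = c ∨ c % 2 = 1 ∧ (b + 1 = c ∨ b = c + 1)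

theorem mem_lineCell_even {k : ℕ} (hk : k % 2 = 0) {x : ℝ} : x ∈ lineCell k ↔ 2 * x = k := by
  simp [lineCell, hk, sub_eq_zero]

theorem mem_lineCell_odd {k : ℕ} (hk : k % 2 = 1) {x : ℝ} : x ∈ lineCell k ↔ |2 * x - k| ≤ 1 := by
  simp [lineCell, hk]

theorem isClosed_lineCell (k : ℕ) : IsClosed (lineCell k) :=
  isClosed_le (by fun_prop) continuous_const

namespace LineFace

variable {a b c d : ℕ}

theorem mod_le (h : LineFace b c) : b % 2 ≤ c % 2 := by
  unfold LineFace at h; omega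

theorem mod_lt (h : LineFace b c) (hne : b ≠ c) : b % 2 < c % 2 := by
  unfold LineFace at h; omega

theorem trans (h : LineFace a b) (h' : LineFace b c) : LineFace a c := by
  unfold LineFace at *; omega

theorem eq_of_odd (h : LineFace b c) (hb : b % 2 = 1) : b = c := by
  unfold LineFace at h; omega

theorem subset (h : LineFace b c) : lineCell b ⊆ lineCell c := by
  rcases h with rfl | ⟨hc, h⟩
  · exact subset_rfl
  · intro x hx
    rw [mem_lineCell_even (by omega)] at hx
    rw [mem_lineCell_odd hc, abs_le]
    rcases h with rfl | rfl
    · push_cast; constructor <;> linarith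
    · push_cast at hx; constructor <;> linarith

theorem exists_of_mem {x : ℝ} (hc : x ∈ lineCell c) (hd : x ∈ lineCell d) :
    ∃ b, LineFace b c ∧ LineFace b d ∧ x ∈ lineCell b := by
  by_cases hcd : c = d
  · exact ⟨c, Or.inl rfl, Or.inl hcd, hc⟩
  rcases Nat.mod_two_eq_zero_or_one c with hc2 | hc2 <;>
    rcases Nat.mod_two_eq_zero_or_one d with hd2 | hd2
  · rw [mem_lineCell_even hc2] at hc
    rw [mem_lineCell_even hd2, hc] at hd
    exact absurd (by exact_mod_cast hd) hcd
  · rw [mem_lineCell_odd hd2, (mem_lineCell_even hc2).1 hc, abs_le] at hd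
    have h1 : (d : ℝ) ≤ c + 1 := by linarith
    have h2 : (c : ℝ) ≤ d + 1 := by linarith
    norm_cast at h1 h2
    exact ⟨c, Or.inl rfl, Or.inr ⟨hd2, by omega⟩, hc⟩
  · rw [mem_lineCell_odd hc2, (mem_lineCell_even hd2).1 hd, abs_le] at hc
    have h1 : (d : ℝ) ≤ c + 1 := by linarith
    have h2 : (c : ℝ) ≤ d + 1 := by linarith
    norm_cast at h1 h2
    exact ⟨d, Or.inr ⟨hc2, by omega⟩, Or.inl rfl, hd⟩
  · rw [mem_lineCell_odd hc2, abs_le] at hc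
    rw [mem_lineCell_odd hd2, abs_le] at hd
    have h1 : (d : ℝ) ≤ c + 2 := by linarith
    have h2 : (c : ℝ) ≤ d + 2 := by linarith
    norm_cast at h1 h2
    -- Distinct edges that meet are consecutive; their common vertex has the index in between.
    obtain rfl | rfl : d = c + 2 ∨ c = d + 2 := by omega
    · refine ⟨c + 1, Or.inr ⟨hc2, by omega⟩, Or.inr ⟨hd2, by omega⟩, ?_⟩
      rw [mem_lineCell_even (by omega)]
      push_cast at hd ⊢
      linarith
    · refine ⟨d + 1, Or.inr ⟨hc2, by omega⟩, Or.inr ⟨hd2, by omega⟩, ?_⟩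
      rw [mem_lineCell_even (by omega)]
      push_cast at hc ⊢
      linarith

theorem exists_of_abs_eq_one (hc : c % 2 = 1) {x : ℝ} (hx : |2 * x - c| = 1) :
    ∃ b, b ≠ c ∧ LineFace b c ∧ x ∈ lineCell b := by
  rw [abs_eq zero_le_one] at hx
  rcases hx with h | h
  · refine ⟨c + 1, by omega, Or.inr ⟨hc, by omega⟩, ?_⟩
    rw [mem_lineCell_even (by omega)]
    push_cast
    linarith
  · obtain ⟨b, rfl⟩ : ∃ b, c = b + 1 := ⟨c - 1, by omega⟩
    refine ⟨b, by omega, Or.inr ⟨hc, by omega⟩, ?_⟩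
    rw [mem_lineCell_even (by omega)]
    push_cast at h
    linarith

theorem abs_eq_one (h : LineFace b c) (hne : b ≠ c) {x : ℝ} (hx : x ∈ lineCell b) :
    c % 2 = 1 ∧ |2 * x - c| = 1 := by
  rcases h with rfl | ⟨hc, h⟩
  · exact absurd rfl hne
  · refine ⟨hc, ?_⟩
    rw [mem_lineCell_even (by omega)] at hx
    rw [abs_eq zero_le_one, hx]
    rcases h with rfl | rfl
    · right; push_cast; ring
    · left; push_cast; ring

end LineFace

theorem lineCell_subset_Icc {m k : ℕ} (hk : k ≤ 2 * m) : lineCell k ⊆ Icc (0 : ℝ) m := by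
  intro x hx
  rcases Nat.mod_two_eq_zero_or_one k with h | h
  · rw [mem_lineCell_even h] at hx
    have h1 : (k : ℝ) ≤ 2 * m := by exact_mod_cast hk
    have h2 : (0 : ℝ) ≤ k := by positivity
    constructor <;> linarith
  · rw [mem_lineCell_odd h, abs_le] at hx
    have h1 : (k : ℝ) + 1 ≤ 2 * m := by exact_mod_cast (by omega : k + 1 ≤ 2 * m)
    have h2 : (1 : ℝ) ≤ k := by exact_mod_cast (by omega : 1 ≤ k)
    constructor <;> linarith

theorem exists_mem_lineCell {m : ℕ} {x : ℝ} (hx : x ∈ Icc (0 : ℝ) m) :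
    ∃ k ≤ 2 * m, x ∈ lineCell k := by
  rcases hx.2.eq_or_lt with rfl | h
  · refine ⟨2 * m, le_rfl, ?_⟩
    rw [mem_lineCell_even (by omega)]
    push_cast
    rfl
  · have h1 := Nat.floor_le hx.1
    have h2 := Nat.lt_floor_add_one x
    have h3 : ⌊x⌋₊ < m := (Nat.floor_lt hx.1).2 h
    refine ⟨2 * ⌊x⌋₊ + 1, by omega, ?_⟩
    rw [mem_lineCell_odd (by omega), abs_le]
    push_cast
    constructor <;> linarith

/-- The boundary of a cell of the square grid. -/
theorem mem_gridBoundary {m : ℕ} (c : Fin (2 * m + 1) × Fin (2 * m + 1)) (x : ℝ × ℝ) :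
    (x ∈ ⋃ b ∈ {b : Fin (2 * m + 1) × Fin (2 * m + 1) |
      LineFace b.1 c.1 ∧ LineFace b.2 c.2 ∧ b ≠ c}, lineCell b.1 ×ˢ lineCell b.2) ↔
    x ∈ lineCell c.1 ×ˢ lineCell c.2 ∧
      (((c.1 : ℕ) % 2 = 1 ∧ |2 * x.1 - (c.1 : ℕ)| = 1) ∨
        ((c.2 : ℕ) % 2 = 1 ∧ |2 * x.2 - (c.2 : ℕ)| = 1)) := by
  have hlt : ∀ (b : ℕ) (c : Fin (2 * m + 1)), LineFace b c → b < 2 * m + 1 := by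
    intro b c h
    have := c.2
    unfold LineFace at h
    omega
  simp only [mem_iUnion₂, mem_ofPred_eq]
  constructor
  · rintro ⟨b, ⟨h1, h2, hne⟩, hx1, hx2⟩
    refine ⟨⟨h1.subset hx1, h2.subset hx2⟩, ?_⟩
    by_cases hb : b.1 = c.1
    · right
      refine h2.abs_eq_one (fun h => hne (Prod.ext hb (Fin.ext h))) hx2
    · left
      exact h1.abs_eq_one (fun h => hb (Fin.ext h)) hx1
  · rintro ⟨⟨hx1, hx2⟩, ⟨hc, h⟩ | ⟨hc, h⟩⟩
    · obtain ⟨b, hne, hb, hxb⟩ := LineFace.exists_of_abs_eq_one hc h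
      refine ⟨(⟨b, hlt b _ hb⟩, c.2), ⟨hb, Or.inl rfl, fun h => hne ?_⟩, hxb, hx2⟩
      rw [← h]
    · obtain ⟨b, hne, hb, hxb⟩ := LineFace.exists_of_abs_eq_one hc h
      refine ⟨(c.1, ⟨b, hlt b _ hb⟩), ⟨Or.inl rfl, hb, fun h => hne ?_⟩, hx1, hxb⟩
      rw [← h]

section

variable {X : Type*} [TopologicalSpace X] {Y : Set X}

/-- The parities of the two indices decide whether the cell is a point, a segment in one of two
directions, or a square. In each case an injective affine map of a unit ball (a square in the sup
norm) is a characteristic map. -/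
theorem cellExtends_grid (h0 : ∀ V : Set X, IsOpen V → Compresses PUnit.{1} Y V)
    (h1 : ∀ V : Set X, IsOpen V → Compresses ℝ Y V) {m : ℕ}
    (c : Fin (2 * m + 1) × Fin (2 * m + 1)) {V : Set X} (hV : IsOpen V)
    (h2 : (c.1 : ℕ) % 2 = 1 → (c.2 : ℕ) % 2 = 1 → Compresses (ℝ × ℝ) Y V) :
    CellExtends Y (lineCell c.1 ×ˢ lineCell c.2)
      (⋃ b ∈ {b : Fin (2 * m + 1) × Fin (2 * m + 1) |
        LineFace b.1 c.1 ∧ LineFace b.2 c.2 ∧ b ≠ c}, lineCell b.1 ×ˢ lineCell b.2) V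
      (((c.1 : ℕ) % 2 + (c.2 : ℕ) % 2 : ℕ) : ℝ) := by
  have hbd := mem_gridBoundary c
  have hodd : ∀ (k : ℕ) (x : ℝ), 2 * ((k + x) / 2) - k = x := fun k x => by ring
  rcases Nat.mod_two_eq_zero_or_one c.1 with e1 | e1 <;>
    rcases Nat.mod_two_eq_zero_or_one c.2 with e2 | e2
  · have := cellExtends_of_characteristicMap (h0 V hV) (φ := fun _ =>
      (((c.1 : ℕ) / 2 : ℝ), ((c.2 : ℕ) / 2 : ℝ))) continuousOn_const
      (fun _ _ _ _ _ => Or.inl rfl) (k := 0) le_rfl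
    convert this using 1
    · ext ⟨x, y⟩
      simp only [mem_prod, mem_lineCell_even e1, mem_lineCell_even e2, mem_image]
      constructor
      · rintro ⟨hx, hy⟩
        exact ⟨0, by simp, by rw [← hx, ← hy]; simp⟩
      · rintro ⟨-, -, h⟩
        rw [Prod.mk.injEq] at h
        constructor <;> linarith [h.1, h.2]
    · ext x
      rw [hbd]
      simp [e1, e2]
    · simp [e1, e2]
  · have := cellExtends_of_characteristicMap (h1 V hV) (φ := fun x =>
      (((c.1 : ℕ) / 2 : ℝ), (((c.2 : ℕ) + x) / 2 : ℝ))) (by fun_prop)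
      (fun x _ y _ h => Or.inl (by
        rw [Prod.mk.injEq] at h
        linarith [h.2])) (k := 1) zero_le_one
    convert this using 1
    · ext ⟨x, y⟩
      simp only [mem_prod, mem_lineCell_even e1, mem_lineCell_odd e2, mem_image,
        mem_closedBall_zero_iff, Real.norm_eq_abs, Prod.mk.injEq]
      constructor
      · rintro ⟨hx, hy⟩
        exact ⟨_, hy, by linarith, by ring⟩
      · rintro ⟨z, hz, rfl, rfl⟩
        exact ⟨by ring, by rwa [hodd]⟩
    · ext ⟨x, y⟩
      rw [hbd]
      simp only [mem_prod, mem_lineCell_even e1, mem_lineCell_odd e2, mem_image, e1, e2,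
        mem_sphere_zero_iff_norm, Real.norm_eq_abs, Prod.mk.injEq]
      constructor
      · rintro ⟨⟨hx, -⟩, ⟨h, -⟩ | ⟨-, hy⟩⟩
        · exact absurd h zero_ne_one
        · exact ⟨_, hy, by linarith, by ring⟩
      · rintro ⟨z, hz, rfl, rfl⟩
        rw [hodd]
        exact ⟨⟨by ring, hz.le⟩, Or.inr ⟨trivial, hz⟩⟩
    · simp [e1, e2]
  · have := cellExtends_of_characteristicMap (h1 V hV) (φ := fun x =>
      ((((c.1 : ℕ) + x) / 2 : ℝ), ((c.2 : ℕ) / 2 : ℝ))) (by fun_prop)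
      (fun x _ y _ h => Or.inl (by
        rw [Prod.mk.injEq] at h
        linarith [h.1])) (k := 1) zero_le_one
    convert this using 1
    · ext ⟨x, y⟩
      simp only [mem_prod, mem_lineCell_even e2, mem_lineCell_odd e1, mem_image,
        mem_closedBall_zero_iff, Real.norm_eq_abs, Prod.mk.injEq]
      constructor
      · rintro ⟨hx, hy⟩
        exact ⟨_, hx, by ring, by linarith⟩
      · rintro ⟨z, hz, rfl, rfl⟩
        exact ⟨by rwa [hodd], by ring⟩
    · ext ⟨x, y⟩
      rw [hbd]
      simp only [mem_prod, mem_lineCell_even e2, mem_lineCell_odd e1, mem_image, e1, e2,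
        mem_sphere_zero_iff_norm, Real.norm_eq_abs, Prod.mk.injEq]
      constructor
      · rintro ⟨⟨-, hy⟩, ⟨-, hx⟩ | ⟨h, -⟩⟩
        · exact ⟨_, hx, by ring, by linarith⟩
        · exact absurd h zero_ne_one
      · rintro ⟨z, hz, rfl, rfl⟩
        rw [hodd]
        exact ⟨⟨hz.le, by ring⟩, Or.inl ⟨trivial, hz⟩⟩
    · simp [e1, e2]
  · have := cellExtends_of_characteristicMap (h2 e1 e2) (φ := fun x =>
      ((((c.1 : ℕ) + x.1) / 2 : ℝ), (((c.2 : ℕ) + x.2) / 2 : ℝ))) (by fun_prop)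
      (fun x _ y _ h => Or.inl (by
        rw [Prod.mk.injEq] at h
        exact Prod.ext (by linarith [h.1]) (by linarith [h.2]))) (k := 2) zero_le_two
    convert this using 1
    · ext ⟨x, y⟩
      simp only [mem_prod, mem_lineCell_odd e2, mem_lineCell_odd e1, mem_image,
        mem_closedBall_zero_iff, Prod.norm_def, sup_le_iff, Real.norm_eq_abs, Prod.mk.injEq]
      constructor
      · rintro ⟨hx, hy⟩
        exact ⟨(_, _), ⟨hx, hy⟩, by ring, by ring⟩
      · rintro ⟨⟨z, w⟩, ⟨hz, hw⟩, rfl, rfl⟩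
        rw [hodd, hodd]
        exact ⟨hz, hw⟩
    · have hmax : ∀ a b : ℝ, max a b = 1 ↔ (a ≤ 1 ∧ b ≤ 1) ∧ (a = 1 ∨ b = 1) := by
        intro a b
        constructor
        · intro h
          refine ⟨⟨(le_max_left _ _).trans h.le, (le_max_right _ _).trans h.le⟩, ?_⟩
          rcases max_choice a b with h' | h' <;> rw [h'] at h <;> simp [h]
        · rintro ⟨⟨h1, h2⟩, rfl | rfl⟩
          · exact max_eq_left h2
          · exact max_eq_right h1
      ext ⟨x, y⟩
      rw [hbd]
      simp only [mem_prod, mem_lineCell_odd e2, mem_lineCell_odd e1, mem_image, e1, e2, true_and,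
        mem_sphere_zero_iff_norm, Prod.norm_def, Real.norm_eq_abs, Prod.mk.injEq, hmax]
      constructor
      · rintro ⟨⟨hx, hy⟩, h⟩
        exact ⟨(_, _), ⟨⟨hx, hy⟩, h⟩, by ring, by ring⟩
      · rintro ⟨⟨z, w⟩, h, rfl, rfl⟩
        rw [hodd, hodd]
        exact h
    · simp [e1, e2]

/-- Squares can be compressed off `Y` if this is possible locally. -/
theorem compresses_square_of_local (h0 : ∀ V : Set X, IsOpen V → Compresses PUnit.{1} Y V)
    (h1 : ∀ V : Set X, IsOpen V → Compresses ℝ Y V)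
    (h2 : ∀ x : X, ∃ V, IsOpen V ∧ x ∈ V ∧ Compresses (ℝ × ℝ) Y V) :
    Compresses (ℝ × ℝ) Y univ := by
  intro u hu _ huY
  choose V hV hxV hVc using h2
  obtain ⟨δ, hδ, hball⟩ := lebesgue_number_lemma_of_metric
    (isCompact_iff_isCompact_univ.1 (isCompact_closedBall (0 : ℝ × ℝ) 1))
    (c := fun x => (closedBall (0 : ℝ × ℝ) 1).domRestrict u ⁻¹' V x)
    (fun x => (hV x).preimage (continuousOn_iff_continuous_domRestrict.1 hu))
    (fun z _ => mem_iUnion.2 ⟨u z, hxV _⟩)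
  obtain ⟨n, hn⟩ := exists_nat_one_div_lt hδ
  -- Under `σ'` a unit square of the grid becomes a sup-norm ball of radius `1 / m < δ` about the
  -- image of its centre, so `u` maps it into a single `V i`.
  set m : ℕ := n + 1 with hm
  have hmpos : (0 : ℝ) < m := by positivity
  have hn' : 1 / (m : ℝ) < δ := by push_cast [hm]; exact hn
  let σ' : ℝ × ℝ → ℝ × ℝ := fun p => (2 * p.1 / m - 1, 2 * p.2 / m - 1)
  have hσc : Continuous σ' := by fun_prop
  let f : ℝ × ℝ → X := fun p => u (σ' p)
  have habs : ∀ r ∈ Icc (0 : ℝ) m, |2 * r / m - 1| ≤ 1 := by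
    intro r hr
    have h1 : r / m ≤ 1 := div_le_one_of_le₀ hr.2 hmpos.le
    have h2 : 0 ≤ r / m := div_nonneg hr.1 hmpos.le
    rw [mul_div_assoc, abs_le]
    constructor <;> linarith
  have hσB : ∀ p ∈ (Icc (0 : ℝ) m ×ˢ Icc (0 : ℝ) m : Set (ℝ × ℝ)), σ' p ∈ closedBall 0 1 := by
    rintro p ⟨hp1, hp2⟩
    rw [mem_closedBall_zero_iff, Prod.norm_def]
    exact max_le (habs _ hp1) (habs _ hp2)
  let e : Fin (2 * m + 1) × Fin (2 * m + 1) → Set (ℝ × ℝ) := fun c => lineCell c.1 ×ˢ lineCell c.2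
  have he : ∀ c, e c ⊆ Icc (0 : ℝ) m ×ˢ Icc (0 : ℝ) m := fun c =>
    prod_mono (lineCell_subset_Icc (by omega)) (lineCell_subset_Icc (by omega))
  have hcover : ⋃ c, e c = Icc (0 : ℝ) m ×ˢ Icc (0 : ℝ) m := by
    refine subset_antisymm (iUnion_subset he) ?_
    rintro ⟨x, y⟩ ⟨hx, hy⟩
    obtain ⟨k, hk, hkx⟩ := exists_mem_lineCell hx
    obtain ⟨l, hl, hly⟩ := exists_mem_lineCell hy
    exact mem_iUnion.2 ⟨(⟨k, by omega⟩, ⟨l, by omega⟩), hkx, hly⟩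
  have hf : ContinuousOn f (⋃ c, e c) := by
    rw [hcover]
    exact hu.comp hσc.continuousOn hσB
  have hsmall : ∀ d, ∃ i : X, (d.1 : ℕ) % 2 = 1 → (d.2 : ℕ) % 2 = 1 → MapsTo f (e d) (V i) := by
    intro d
    by_cases hd : (d.1 : ℕ) % 2 = 1 ∧ (d.2 : ℕ) % 2 = 1
    · let p₀ : ℝ × ℝ := ((d.1 : ℕ) / 2, (d.2 : ℕ) / 2)
      have hp₀ : p₀ ∈ e d := by
        refine ⟨?_, ?_⟩
        · rw [mem_lineCell_odd hd.1]; simp [p₀, mul_div_cancel₀]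
        · rw [mem_lineCell_odd hd.2]; simp [p₀, mul_div_cancel₀]
      obtain ⟨i, hi⟩ := hball ⟨σ' p₀, hσB _ (he d hp₀)⟩ trivial
      refine ⟨i, fun _ _ p hp => ?_⟩
      have hp' := hp
      obtain ⟨hp1, hp2⟩ := hp
      rw [mem_lineCell_odd hd.1] at hp1
      rw [mem_lineCell_odd hd.2] at hp2
      refine @hi ⟨σ' p, hσB _ (he d hp')⟩ ?_
      have key : ∀ (r : ℝ) (k : ℕ), |2 * r - k| ≤ 1 →
          |(2 * r / m - 1) - (2 * ((k : ℝ) / 2) / m - 1)| ≤ 1 / m := by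
        intro r k h
        have : (2 * r / m - 1) - (2 * ((k : ℝ) / 2) / m - 1) = (2 * r - k) / m := by
          field_simp
          ring
        rw [this, abs_div, abs_of_pos hmpos]
        exact div_le_div_of_nonneg_right h hmpos.le
      rw [mem_ball, Subtype.dist_eq, Prod.dist_eq]
      exact (max_le (key _ _ hp1) (key _ _ hp2)).trans_lt hn'
    · exact ⟨u 0, fun h h' => absurd ⟨h, h'⟩ hd⟩
  choose idx hidx using hsmall
  let le : Fin (2 * m + 1) × Fin (2 * m + 1) → Fin (2 * m + 1) × Fin (2 * m + 1) → Prop :=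
    fun b c => LineFace b.1 c.1 ∧ LineFace b.2 c.2
  -- A cell must stay in the sets chosen for all squares containing it. This makes `V'` monotone
  -- along faces, and it is open as a finite intersection.
  let V' : Fin (2 * m + 1) × Fin (2 * m + 1) → Set X := fun c =>
    ⋂ d ∈ {d : Fin (2 * m + 1) × Fin (2 * m + 1) |
      (d.1 : ℕ) % 2 = 1 ∧ (d.2 : ℕ) % 2 = 1 ∧ le c d}, V (idx d)
  have hle_sub : ∀ b c, le b c → e b ⊆ e c := fun b c h => prod_mono h.1.subset h.2.subset
  obtain ⟨F, hF, hFc⟩ := exists_homotopy_of_cellExtends (Y := Y)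
    (fun c : Fin (2 * m + 1) × Fin (2 * m + 1) => (c.1 : ℕ) % 2 + (c.2 : ℕ) % 2)
    (fun b c => LineFace b.1 c.1 ∧ LineFace b.2 c.2 ∧ b ≠ c) e V'
    -- The cells on the boundary of the large square are held fixed.
    (fun c => ((c.1 : ℕ) = 0 ∨ (c.1 : ℕ) = 2 * m) ∨ ((c.2 : ℕ) = 0 ∨ (c.2 : ℕ) = 2 * m))
    (fun c => (isClosed_lineCell _).prod (isClosed_lineCell _))
    (fun b c ⟨h1, h2, hne⟩ => by
      have := h1.mod_le
      have := h2.mod_le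
      by_cases hb : b.1 = c.1
      · have := h2.mod_lt fun h => hne (Prod.ext hb (Fin.ext h))
        omega
      · have := h1.mod_lt fun h => hb (Fin.ext h)
        omega)
    (fun b c h => hle_sub b c ⟨h.1, h.2.1⟩)
    (fun b c h => by
      intro x hx
      simp only [V', mem_iInter₂] at hx ⊢
      exact fun d hd => hx d ⟨hd.1, hd.2.1, h.1.trans hd.2.2.1, h.2.1.trans hd.2.2.2⟩)
    (fun b c ⟨h1, h2, _⟩ hc => by
      unfold LineFace at h1 h2
      omega)
    (fun c d hdc hr => by
      rintro ⟨x, y⟩ ⟨⟨hxd, hyd⟩, ⟨hxc, hyc⟩⟩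
      obtain ⟨b1, hb1c, hb1d, hxb⟩ := LineFace.exists_of_mem hxc hxd
      obtain ⟨b2, hb2c, hb2d, hyb⟩ := LineFace.exists_of_mem hyc hyd
      have hlt : ∀ (b : ℕ) (c : Fin (2 * m + 1)), LineFace b c → b < 2 * m + 1 := by
        intro b c h
        have := c.2
        unfold LineFace at h
        omega
      refine mem_iUnion₂.2 ⟨(⟨b1, hlt _ _ hb1c⟩, ⟨b2, hlt _ _ hb2c⟩), ⟨hb1c, hb2c, ?_⟩, hxb, hyb⟩
      intro hbc
      have q1 : b1 = (c.1 : ℕ) := congrArg (fun b => (b.1 : ℕ)) hbc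
      have q2 : b2 = (c.2 : ℕ) := congrArg (fun b => (b.2 : ℕ)) hbc
      have l1 := hb1d.mod_le
      have l2 := hb2d.mod_le
      by_cases hb : b1 = d.1
      · by_cases hb' : b2 = d.2
        · exact hdc (Prod.ext (Fin.ext (hb.symm.trans q1)) (Fin.ext (hb'.symm.trans q2)))
        · have := hb2d.mod_lt hb'
          omega
      · have := hb1d.mod_lt hb
        omega)
    hf
    (fun c x hx => by
      simp only [V', mem_iInter₂]
      exact fun d hd => hidx d hd.1 hd.2.1 (hle_sub c d hd.2.2 hx))
    (fun c hc x hx => by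
      refine huY ?_
      have hxI := he c hx
      rw [mem_sphere_zero_iff_norm, Prod.norm_def]
      have key : ∀ (k : ℕ) (r : ℝ), r ∈ lineCell k → (k = 0 ∨ k = 2 * m) →
          |2 * r / m - 1| = 1 := by
        intro k r hr hk
        rw [mem_lineCell_even (by omega)] at hr
        rw [hr]
        rcases hk with rfl | rfl
        · simp
        · push_cast
          rw [mul_div_assoc, div_self hmpos.ne']
          norm_num
      rcases hc with h | h
      · have := key _ _ hx.1 h
        simp only [σ', Real.norm_eq_abs, this]
        exact max_eq_left (habs _ hxI.2)
      · have := key _ _ hx.2 h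
        simp only [σ', Real.norm_eq_abs, this]
        exact max_eq_right (habs _ hxI.1))
    (fun c _ => cellExtends_grid h0 h1 c ((toFinite _).isOpen_biInter fun d _ => hV _)
      fun o1 o2 => by
        -- A square is a face of no other cell, so the intersection has only one term.
        have : V' c = V (idx c) := by
          refine subset_antisymm (biInter_subset_of_mem ⟨o1, o2, Or.inl rfl, Or.inl rfl⟩) ?_
          refine subset_iInter₂ fun d hd => ?_
          have : c = d := Prod.ext (Fin.ext (hd.2.2.1.eq_of_odd o1))
            (Fin.ext (hd.2.2.2.eq_of_odd o2))
          rw [this]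
        rw [this]
        exact hVc _)
  rw [hcover] at hF
  let τ : ℝ × ℝ → ℝ × ℝ := fun p => (m * (1 + p.1) / 2, m * (1 + p.2) / 2)
  have hτ : ∀ p ∈ closedBall (0 : ℝ × ℝ) 1, τ p ∈ (Icc (0 : ℝ) m ×ˢ Icc (0 : ℝ) m) := by
    intro p hp
    rw [mem_closedBall_zero_iff, Prod.norm_def] at hp
    have key : ∀ r : ℝ, |r| ≤ 1 → m * (1 + r) / 2 ∈ Icc (0 : ℝ) m := by
      intro r hr
      rw [abs_le] at hr
      constructor <;> nlinarith
    exact ⟨key _ ((le_max_left _ _).trans hp), key _ ((le_max_right _ _).trans hp)⟩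
  have hστ : ∀ p, σ' (τ p) = p := by
    intro p
    ext
    · simp only [σ', τ]
      field_simp
      ring
    · simp only [σ', τ]
      field_simp
      ring
  have hex : ∀ p ∈ closedBall (0 : ℝ × ℝ) 1, ∃ c, τ p ∈ e c := fun p hp => by
    have := hτ p hp
    rw [← hcover] at this
    exact mem_iUnion.1 this
  -- Ranks are at most 2, so every cell is at rest and off `Y` by time 3.
  refine ⟨fun q => F (τ q.1, 3 * q.2), ?_, fun _ _ => trivial, ?_, ?_, ?_⟩
  · refine hF.comp (by fun_prop) ?_
    exact fun q hq => ⟨hτ _ hq.1, mul_nonneg (by norm_num) hq.2.1⟩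
  · intro p hp
    obtain ⟨c, hc⟩ := hex p hp
    simp only [mul_zero]
    rw [(hFc c _ hc).1]
    simp only [f, hστ]
  · intro p hp t ht
    have hp' := sphere_subset_closedBall hp
    have hbdry : ∀ r : ℝ, |r| = 1 → ∃ k ≤ 2 * m, (k = 0 ∨ k = 2 * m) ∧
        m * (1 + r) / 2 ∈ lineCell k := by
      intro r hr
      rw [abs_eq zero_le_one] at hr
      rcases hr with rfl | rfl
      · refine ⟨2 * m, le_rfl, Or.inr rfl, ?_⟩
        rw [mem_lineCell_even (by omega)]
        push_cast
        ring
      · refine ⟨0, by omega, Or.inl rfl, ?_⟩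
        rw [mem_lineCell_even (by omega)]
        simp
    obtain ⟨c, hc, hcZ⟩ : ∃ c, τ p ∈ e c ∧
        (((c.1 : ℕ) = 0 ∨ (c.1 : ℕ) = 2 * m) ∨ ((c.2 : ℕ) = 0 ∨ (c.2 : ℕ) = 2 * m)) := by
      obtain ⟨c, hc⟩ := hex p hp'
      rw [mem_sphere_zero_iff_norm, Prod.norm_def] at hp
      rcases max_choice ‖p.1‖ ‖p.2‖ with h | h <;> rw [h, Real.norm_eq_abs] at hp
      · obtain ⟨k, hk, hk', hkm⟩ := hbdry _ hp
        exact ⟨(⟨k, by omega⟩, c.2), ⟨hkm, hc.2⟩, Or.inl hk'⟩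
      · obtain ⟨k, hk, hk', hkm⟩ := hbdry _ hp
        exact ⟨(c.1, ⟨k, by omega⟩), ⟨hc.1, hkm⟩, Or.inr hk'⟩
    simp only
    rw [(hFc c _ hc).2.1 hcZ _ (mul_nonneg (by norm_num) ht.1)]
    simp only [f, hστ]
  · intro p hp
    obtain ⟨c, hc⟩ := hex p hp
    obtain ⟨-, -, -, h4, h5⟩ := hFc c _ hc
    have hr : (((c.1 : ℕ) % 2 + (c.2 : ℕ) % 2 : ℕ) + 1 : ℝ) ≤ 3 * 1 := by
      have : (c.1 : ℕ) % 2 + (c.2 : ℕ) % 2 + 1 ≤ 3 := by omega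
      have : (((c.1 : ℕ) % 2 + (c.2 : ℕ) % 2 : ℕ) + 1 : ℝ) ≤ 3 := by exact_mod_cast this
      linarith
    simp only
    rw [h4 _ hr]
    exact h5

end

end

/-! ### The simplices of a triangulation as cells. -/

section

open Set Metric Topology unitInterval AbstractSimplicialComplex

namespace Triangulation

variable {κ S : Type*} [TopologicalSpace S]

theorem isClosed_simplex (N : Triangulation κ S) (s : Finset κ) : IsClosed (N.simplex s) := by
  have h := (Realization.isClosed_biUnion_simplex (K := N.complex) {s}).preimage
    N.homeo.symm.continuous
  rw [biUnion_singleton] at h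
  exact h

theorem coord_homeo (N : Triangulation κ S) (x : N.complex.Realization) :
    N.coord (N.homeo x) = x.1 := by
  simp [coord]

theorem support_coord_mem (N : Triangulation κ S) (z : S) :
    (N.coord z).support ∈ N.complex.faces := (N.homeo.symm z).2.1

theorem simplex_mono (N : Triangulation κ S) {s t : Finset κ} (h : s ⊆ t) :
    N.simplex s ⊆ N.simplex t := fun _ hz => Finset.Subset.trans hz h

open Classical in
/-- The barycenter of a face. -/
noncomputable def barycenter (N : Triangulation κ S) {s : Finset κ} (hs : s ∈ N.complex.faces) :
    N.complex.Realization :=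
  Realization.ofCoords hs ⟨fun i => if i ∈ s then (s.card : ℝ)⁻¹ else 0, fun i => by
      simp only
      split_ifs <;> positivity, fun i hi => if_neg hi, by
      rw [Finset.sum_congr rfl fun i hi => if_pos hi, Finset.sum_const, nsmul_eq_mul]
      exact mul_inv_cancel₀ (by exact_mod_cast (nonempty_of_mem_faces hs).card_ne_zero)⟩

theorem support_barycenter (N : Triangulation κ S) {s : Finset κ} (hs : s ∈ N.complex.faces) :
    (N.barycenter hs).1.support = s := by
  ext i
  rw [Finsupp.mem_support_iff, barycenter, Realization.ofCoords_apply]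
  have : (s.card : ℝ)⁻¹ ≠ 0 :=
    inv_ne_zero (by exact_mod_cast (nonempty_of_mem_faces hs).card_ne_zero)
  by_cases h : i ∈ s <;> simp [h, this]

/-- A triangulation of a compact space is finite. -/
theorem finite_faces (N : Triangulation κ S) [CompactSpace S] : N.complex.faces.Finite := by
  have : CompactSpace N.complex.Realization := N.homeo.symm.compactSpace
  let b : N.complex.faces → N.complex.Realization := fun s => N.barycenter s.2
  have hb : Function.Injective b := fun s t h => Subtype.ext (by
    rw [← N.support_barycenter s.2, ← N.support_barycenter t.2]
    exact congrArg (fun x : N.complex.Realization => x.1.support) h)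
  -- A closed simplex contains only the barycentres of its own faces, so every set of barycentres is
  -- closed. The barycentres thus form a closed discrete subset of a compact space.
  have hclosed : ∀ Q : Set N.complex.faces, IsClosed (b '' Q) := by
    intro Q
    refine Realization.isClosed_iff.2 fun r hr => Set.Finite.isClosed ?_
    have hinj : Function.Injective (Realization.ofCoords hr) := fun x y h =>
      Subtype.ext (funext fun i => congrArg (fun x : N.complex.Realization => x.1 i) h)
    refine Set.Finite.preimage hinj.injOn ?_ |>.subset (s := Realization.ofCoords hr ⁻¹'
      (b '' (Subtype.val ⁻¹' (r.powerset : Set (Finset κ))))) ?_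
    · exact ((r.powerset.finite_toSet).preimage Subtype.val_injective.injOn).image b
    · rintro x ⟨s, -, hs⟩
      refine ⟨s, ?_, hs⟩
      rw [mem_preimage, Finset.mem_coe, Finset.mem_powerset, ← N.support_barycenter s.2]
      change (b s).1.support ⊆ r
      rw [hs]
      exact Realization.support_ofCoords_subset hr x
  let τ : TopologicalSpace N.complex.faces := ⊥
  have : DiscreteTopology N.complex.faces := ⟨rfl⟩
  have hemb : IsClosedEmbedding b :=
    IsClosedEmbedding.of_continuous_injective_isClosedMap continuous_of_discreteTopology hb
      fun Q _ => hclosed Q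
  have : CompactSpace N.complex.faces := hemb.compactSpace
  have := finite_of_compact_of_discrete (X := N.complex.faces)
  exact toFinite _

theorem exists_map_of_coords {E : Type*} [TopologicalSpace E] (N : Triangulation κ S)
    {s : Finset κ} (hs : s ∈ N.complex.faces) {B : Set E} {w : E → κ → ℝ}
    (hw : MapsTo w B (stdFace s)) (hwc : ∀ i, Continuous fun x => w x i) :
    ∃ φ : E → S, ContinuousOn φ B ∧ ∀ x ∈ B, ∀ i, N.coord (φ x) i = w x i := by
  classical
  -- The barycentre is only a default value outside `B`.
  refine ⟨fun x => N.homeo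
    (if hx : x ∈ B then Realization.ofCoords hs ⟨w x, hw hx⟩ else N.barycenter hs), ?_, ?_⟩
  · rw [continuousOn_iff_continuous_domRestrict]
    refine N.homeo.continuous.comp (f := fun x : B =>
      if hx : (x : E) ∈ B then Realization.ofCoords hs ⟨w x, hw hx⟩ else N.barycenter hs) ?_
    have : Continuous fun x : B => Realization.ofCoords hs ⟨w x, hw x.2⟩ :=
      (Realization.continuous_ofCoords hs).comp (Continuous.subtype_mk
        (continuous_pi fun i => (hwc i).comp continuous_subtype_val) _)
    refine this.congr ?_
    rintro ⟨x, hx⟩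
    simp only [dif_pos hx]
  · intro x hx i
    simp only [coord_homeo, dif_pos hx, Realization.ofCoords_apply]

/-- Reduces the matter to barycentric coordinates `w`: the boundary of a simplex is where some
coordinate of `s` vanishes, so `hbd` matches the sphere with the union of the proper faces. -/
theorem cellExtends_simplex {E X : Type*} [NormedAddCommGroup E] [NormedSpace ℝ E]
    [ProperSpace E] [T2Space S] [TopologicalSpace X] {Y V : Set X} (hV : Compresses E Y V)
    (N : Triangulation κ S) (s : N.complex.faces) {w : E → κ → ℝ}
    (hw : MapsTo w (closedBall 0 1) (stdFace s.1))
    (hwc : ∀ i, Continuous fun x => w x i)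
    (hsurj : SurjOn w (closedBall 0 1) (stdFace s.1))
    (hinj : ∀ x ∈ closedBall (0 : E) 1, ∀ y ∈ closedBall (0 : E) 1, w x = w y →
      x = y ∨ x ∈ sphere 0 1 ∧ y ∈ sphere 0 1)
    (hbd : ∀ x ∈ closedBall (0 : E) 1, x ∈ sphere 0 1 ↔ ∃ i ∈ s.1, w x i = 0)
    {k : ℝ} (hk : 0 ≤ k) :
    CellExtends Y (N.simplex s) (⋃ b ∈ {b : N.complex.faces | b.1 ⊂ s.1}, N.simplex b) V k := by
  obtain ⟨φ, hφ, hφcoord⟩ := N.exists_map_of_coords s.2 hw hwc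
  have hinj' : ∀ x ∈ closedBall (0 : E) 1, ∀ y ∈ closedBall (0 : E) 1, φ x = φ y →
      x = y ∨ x ∈ sphere 0 1 ∧ y ∈ sphere 0 1 := by
    intro x hx y hy h
    refine hinj x hx y hy (funext fun i => ?_)
    rw [← hφcoord x hx, ← hφcoord y hy, h]
  have himage : φ '' closedBall 0 1 = N.simplex s := by
    ext z
    constructor
    · rintro ⟨x, hx, rfl⟩ i hi
      by_contra his
      rw [Finsupp.mem_support_iff, hφcoord x hx] at hi
      exact hi ((hw hx).2.1 i his)
    · intro hz
      obtain ⟨x, hx, hxz⟩ := hsurj ((N.homeo.symm z).coords_mem_stdFace hz)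
      refine ⟨x, hx, N.homeo.symm.injective (Realization.ext fun i => ?_)⟩
      exact (hφcoord x hx i).trans (congrFun hxz i)
  have himage' : φ '' sphere 0 1 = ⋃ b ∈ {b : N.complex.faces | b.1 ⊂ s.1}, N.simplex b := by
    ext z
    simp only [mem_iUnion₂, mem_ofPred_eq]
    constructor
    · rintro ⟨x, hx, rfl⟩
      have hx' := sphere_subset_closedBall hx
      obtain ⟨i, hi, hwi⟩ := (hbd x hx').1 hx
      have hmem : φ x ∈ N.simplex s := himage ▸ mem_image_of_mem φ hx'
      refine ⟨⟨_, N.support_coord_mem (φ x)⟩, ?_, Finset.Subset.refl _⟩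
      refine (Finset.ssubset_iff_of_subset hmem).2 ⟨i, hi, ?_⟩
      rw [Finsupp.notMem_support_iff, hφcoord x hx', hwi]
    · rintro ⟨b, hb, hz⟩
      obtain ⟨x, hx, rfl⟩ : z ∈ φ '' closedBall 0 1 := himage ▸ N.simplex_mono hb.1 hz
      obtain ⟨i, hi, hib⟩ := Finset.exists_of_ssubset hb
      refine ⟨x, (hbd x hx).2 ⟨i, hi, ?_⟩, rfl⟩
      rw [← hφcoord x hx]
      exact Finsupp.notMem_support_iff.1 fun h => hib (hz h)
  rw [← himage', ← himage]
  exact cellExtends_of_characteristicMap hV hφ hinj' hk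

theorem cellExtends_of_card_le_three {X : Type*} [T2Space S] [TopologicalSpace X] {Y V : Set X}
    (h0 : Compresses PUnit.{1} Y V) (h1 : Compresses ℝ Y V) (h2 : Compresses (ℝ × ℝ) Y V)
    (N : Triangulation κ S) (s : N.complex.faces) (hs : s.1.card ≤ 3) :
    CellExtends Y (N.simplex s) (⋃ b ∈ {b : N.complex.faces | b.1 ⊂ s.1}, N.simplex b) V
      ((s.1.card - 1 : ℕ) : ℝ) := by
  classical
  have hpos := (nonempty_of_mem_faces s.2).card_pos
  obtain hc | hc | hc : s.1.card = 1 ∨ s.1.card = 2 ∨ s.1.card = 3 := by omega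
  · obtain ⟨a, ha⟩ := Finset.card_eq_one.1 hc
    refine N.cellExtends_simplex h0 s (w := fun _ i => if i = a then 1 else 0) ?_ ?_ ?_ ?_ ?_
      (by positivity)
    · rintro x -
      rw [ha]
      refine ⟨fun i => ?_, fun i hi => ?_, by simp⟩
      · simp only
        split_ifs <;> norm_num
      · simpa using hi
    · exact fun i => continuous_const
    · rintro f ⟨-, hf1, hf2⟩
      rw [ha] at hf1 hf2
      refine ⟨0, by simp, funext fun i => ?_⟩
      by_cases hi : i = a
      · subst hi
        simpa using hf2.symm
      · simp [hi, hf1 i (by simpa using hi)]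
    · exact fun x _ y _ _ => Or.inl rfl
    · intro x _
      simp [ha]
  · obtain ⟨a, b, hab, hab'⟩ := Finset.card_eq_two.1 hc
    have hba := hab.symm
    refine N.cellExtends_simplex h1 s
      (w := fun x i => if i = a then (1 - x) / 2 else if i = b then (1 + x) / 2 else 0)
      ?_ ?_ ?_ ?_ ?_ (by positivity)
    · intro x hx
      rw [mem_closedBall_zero_iff, Real.norm_eq_abs, abs_le] at hx
      rw [hab']
      refine ⟨fun i => ?_, fun i hi => ?_, ?_⟩
      · simp only
        split_ifs <;> linarith [hx.1, hx.2]
      · simp only [Finset.mem_insert, Finset.mem_singleton, not_or] at hi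
        simp [hi.1, hi.2]
      · rw [Finset.sum_pair hab]
        simp only [if_true, if_neg hba]
        ring
    · intro i
      split_ifs <;> fun_prop
    · rintro f ⟨hf0, hf1, hf2⟩
      rw [hab'] at hf1 hf2
      rw [Finset.sum_pair hab] at hf2
      have hfa := hf0 a
      have hfb := hf0 b
      refine ⟨2 * f b - 1, ?_, funext fun i => ?_⟩
      · rw [mem_closedBall_zero_iff, Real.norm_eq_abs, abs_le]
        constructor <;> linarith
      · simp only
        split_ifs with h h'
        · subst h; linarith
        · subst h'; linarith
        · exact (hf1 i (by simp [h, h'])).symm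
    · intro x _ y _ h
      have := congrFun h a
      simp only [if_true] at this
      left; linarith
    · intro x _
      simp only [hab', Finset.mem_insert, Finset.mem_singleton, exists_eq_or_imp, exists_eq_left,
        if_true, if_neg hba, mem_sphere_zero_iff_norm, Real.norm_eq_abs, abs_eq zero_le_one]
      constructor
      · rintro (rfl | rfl) <;> norm_num
      · rintro (h | h)
        · left; linarith
        · right; linarith
  · obtain ⟨a, b, c, hab, hac, hbc, habc⟩ := Finset.card_eq_three.1 hc
    have hba := hab.symm
    have hca := hac.symm
    have hcb := hbc.symm
    have hball : ∀ x : ℝ × ℝ, x ∈ closedBall (0 : ℝ × ℝ) 1 ↔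
        (-1 ≤ x.1 ∧ x.1 ≤ 1) ∧ -1 ≤ x.2 ∧ x.2 ≤ 1 := by
      intro x
      rw [mem_closedBall_zero_iff, Prod.norm_def, sup_le_iff, Real.norm_eq_abs, Real.norm_eq_abs,
        abs_le, abs_le]
    have hsph : ∀ x ∈ closedBall (0 : ℝ × ℝ) 1, x ∈ sphere (0 : ℝ × ℝ) 1 ↔
        (x.1 = 1 ∨ x.1 = -1) ∨ (x.2 = 1 ∨ x.2 = -1) := by
      intro x hx
      rw [mem_closedBall_zero_iff, Prod.norm_def, sup_le_iff, Real.norm_eq_abs,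
        Real.norm_eq_abs] at hx
      rw [mem_sphere_zero_iff_norm, Prod.norm_def, Real.norm_eq_abs, Real.norm_eq_abs,
        ← abs_eq zero_le_one, ← abs_eq zero_le_one]
      constructor
      · intro h
        rcases max_choice |x.1| |x.2| with h' | h' <;> rw [h'] at h <;> simp [h]
      · rintro (h | h)
        · rw [h]; exact max_eq_left hx.2
        · rw [h]; exact max_eq_right hx.1
    -- The square covers the triangle by collapsing the side `x.1 = -1` to the vertex `a`.
    -- Injectivity fails only there, on the sphere, where it is permitted.
    refine N.cellExtends_simplex h2 s
      (w := fun x i => if i = a then (1 - x.1) / 2 else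
        if i = b then (1 + x.1) / 2 * ((1 - x.2) / 2) else
        if i = c then (1 + x.1) / 2 * ((1 + x.2) / 2) else 0)
      ?_ ?_ ?_ ?_ ?_ (by positivity)
    · intro x hx
      obtain ⟨hx1, hx2⟩ := (hball x).1 hx
      rw [habc]
      refine ⟨fun i => ?_, fun i hi => ?_, ?_⟩
      · simp only
        split_ifs
        · linarith
        · exact mul_nonneg (by linarith) (by linarith)
        · exact mul_nonneg (by linarith) (by linarith)
        · exact le_rfl
      · simp only [Finset.mem_insert, Finset.mem_singleton, not_or] at hi
        simp [hi.1, hi.2.1, hi.2.2]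
      · rw [Finset.sum_insert (by simp [hab, hac]), Finset.sum_pair hbc]
        simp only [if_true, if_neg hba, if_neg hca, if_neg hcb]
        ring
    · intro i
      split_ifs <;> fun_prop
    · rintro f ⟨hf0, hf1, hf2⟩
      rw [habc] at hf1 hf2
      rw [Finset.sum_insert (by simp [hab, hac]), Finset.sum_pair hbc] at hf2
      have hfa := hf0 a
      have hfb := hf0 b
      have hfc := hf0 c
      -- At the vertex `a` the second coordinate is undetermined; any point of the collapsed side is
      -- a preimage.
      by_cases hz : f b + f c = 0
      · have e1 : f b = 0 := by linarith
        have e2 : f c = 0 := by linarith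
        have e3 : f a = 1 := by linarith
        refine ⟨(-1, 0), ?_, funext fun i => ?_⟩
        · rw [hball]; norm_num
        · simp only
          split_ifs with h h' h''
          · subst h; rw [e3]; norm_num
          · subst h'; rw [e1]; norm_num
          · subst h''; rw [e2]; norm_num
          · exact (hf1 i (by simp [h, h', h''])).symm
      · have hzpos : 0 < f b + f c := lt_of_le_of_ne (by linarith) (Ne.symm hz)
        have q1 : f c / (f b + f c) ≤ 1 := div_le_one_of_le₀ (by linarith) hzpos.le
        have q2 : 0 ≤ f c / (f b + f c) := div_nonneg hfc hzpos.le
        refine ⟨(2 * (f b + f c) - 1, 2 * (f c / (f b + f c)) - 1), ?_, funext fun i => ?_⟩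
        · rw [hball]
          refine ⟨⟨?_, ?_⟩, ?_, ?_⟩ <;> simp only <;> linarith
        · simp only
          split_ifs with h h' h''
          · subst h; linarith
          · subst h'; field_simp; ring
          · subst h''; field_simp; ring
          · exact (hf1 i (by simp [h, h', h''])).symm
    · intro x hx y hy h
      have e1 := congrFun h a
      have e2 := congrFun h c
      simp only [if_true, if_neg hca, if_neg hcb] at e1 e2
      have e3 : x.1 = y.1 := by linarith
      by_cases hx1 : x.1 = -1
      · right
        rw [hsph x hx, hsph y hy]
        exact ⟨Or.inl (Or.inr hx1), Or.inl (Or.inr (e3 ▸ hx1))⟩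
      · left
        refine Prod.ext e3 ?_
        rw [← e3] at e2
        have hne : (1 + x.1) / 2 ≠ 0 := fun h0 => hx1 (by linarith)
        have := mul_left_cancel₀ hne e2
        linarith
    · intro x hx
      rw [hsph x hx]
      simp only [habc, Finset.mem_insert, Finset.mem_singleton, exists_eq_or_imp, exists_eq_left,
        if_true, if_neg hba, if_neg hca, if_neg hcb, mul_eq_zero]
      constructor
      · rintro ((h | h) | (h | h)) <;> rw [h] <;> norm_num
      · rintro (h | (h | h) | (h | h))
        · left; left; linarith
        · left; right; linarith
        · right; left; linarith
        · left; right; linarith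
        · right; right; linarith

end Triangulation

/-! ### The dimension bound for triangulated surfaces. -/

/-- A three-dimensional ball does not embed in the plane. -/
theorem not_injOn_of_continuousOn {g : (ℝ × ℝ) × ℝ → ℂ} (hg : ContinuousOn g (closedBall 0 1)) :
    ¬ InjOn g (closedBall 0 1) := by
  intro hinj
  -- The retraction onto the unit ball extends everything to the whole plane, which is simply
  -- connected, so that phases lift.
  let c : ℝ × ℝ → ℝ × ℝ := fun z => (max 1 ‖z‖)⁻¹ • z
  have hmax : ∀ z : ℝ × ℝ, 0 < max 1 ‖z‖ := fun z => lt_max_of_lt_left one_pos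
  have hc : Continuous c :=
    (Continuous.inv₀ (by fun_prop) fun z => (hmax z).ne').smul continuous_id
  have hc1 : ∀ z, ‖c z‖ ≤ 1 := by
    intro z
    rw [norm_smul, norm_inv, Real.norm_eq_abs, abs_of_pos (hmax z), inv_mul_le_iff₀ (hmax z),
      mul_one]
    exact le_max_right _ _
  have hcs : ∀ z : ℝ × ℝ, ‖z‖ = 1 → c z = z := by
    intro z hz
    simp [c, hz]
  -- The graph of `1 - ‖·‖` plays the role of the upper hemisphere. It avoids its own negative
  -- pointwise, so the antipodal difference `k` has no zeros, and `k` is odd on the boundary circle.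
  let φ : ℝ × ℝ → (ℝ × ℝ) × ℝ := fun z => (c z, 1 - ‖c z‖)
  have hφ : Continuous φ := by fun_prop
  have hφB : ∀ z, φ z ∈ closedBall 0 1 := by
    intro z
    rw [mem_closedBall_zero_iff, Prod.norm_def]
    refine max_le (hc1 z) ?_
    rw [Real.norm_eq_abs, abs_le]
    constructor <;> linarith [hc1 z, norm_nonneg (c z)]
  have hφB' : ∀ z, -φ z ∈ closedBall 0 1 := fun z => by
    have := hφB z
    rw [mem_closedBall_zero_iff] at this ⊢
    rwa [norm_neg]
  have hφ0 : ∀ z, φ z ≠ -φ z := by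
    intro z h
    have h0 : φ z = 0 := self_eq_neg.1 h
    obtain ⟨h1, h2⟩ := Prod.mk_eq_zero.1 h0
    rw [h1] at h2
    simp at h2
  let k : ℝ × ℝ → ℂ := fun z => g (φ z) - g (-φ z)
  have hk : Continuous k :=
    (hg.comp_continuous hφ hφB).sub (hg.comp_continuous hφ.neg hφB')
  have hk0 : ∀ z, k z ≠ 0 := fun z h => hφ0 z (hinj (hφB z) (hφB' z) (sub_eq_zero.1 h))
  have hkodd : ∀ z : ℝ × ℝ, ‖z‖ = 1 → k (-z) = -k z := by
    intro z hz
    have h1 : φ z = (z, 0) := by simp [φ, hcs z hz, hz]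
    have h2 : φ (-z) = (-z, 0) := by
      have := hcs (-z) (by rwa [norm_neg])
      simp [φ, this, hz]
    simp only [k, h1, h2]
    simp
  have hkn : ∀ z, ‖k z‖ ≠ 0 := fun z => norm_ne_zero_iff.2 (hk0 z)
  let q : C(ℝ × ℝ, Circle) := ⟨fun z => ⟨k z / ‖k z‖, by
      simp [Submonoid.unitSphere, hkn z]⟩, by
    refine Continuous.subtype_mk (hk.div₀ (Complex.continuous_ofReal.comp hk.norm) fun z => ?_) _
    exact Complex.ofReal_ne_zero.2 (hkn z)⟩
  obtain ⟨t₀, ht₀⟩ := Circle.exp_surjective (q 0)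
  obtain ⟨L, ⟨-, hL⟩, -⟩ := Circle.isCoveringMap_exp.existsUnique_continuousMap_lifts q 0 t₀ ht₀
  have hLq : ∀ z, Complex.exp (L z * Complex.I) = k z / ‖k z‖ := fun z => by
    exact congrArg Subtype.val (congrFun hL z)
  -- The jump of the phase between antipodes changes sign after half a turn, so it vanishes
  -- somewhere. There `k` has the same phase at both antipodes, contradicting oddness.
  let d : ℝ → ℝ := fun t => L (-squareLoop t) - L (squareLoop t)
  have hd : Continuous d := by
    have := continuous_squareLoop
    fun_prop
  have hhalf : squareLoop (1 / 2) = -squareLoop 0 := by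
    have : 2 * Real.pi * (1 / 2) = Real.pi := by ring
    simp only [squareLoop, this]
    simp [Prod.norm_def]
  have hd0 : d (1 / 2) = -d 0 := by
    simp only [d, hhalf, neg_neg]
    ring
  obtain ⟨t, ht⟩ : ∃ t, d t = 0 := by
    rcases le_total (d 0) 0 with h | h
    · exact mem_range_of_exists_le_of_exists_ge hd ⟨0, h⟩ ⟨1 / 2, by rw [hd0]; linarith⟩
    · exact mem_range_of_exists_le_of_exists_ge hd ⟨1 / 2, by rw [hd0]; linarith⟩ ⟨0, h⟩
  have h1 := hLq (-squareLoop t)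
  have h2 := hLq (squareLoop t)
  rw [sub_eq_zero.1 ht, h2, hkodd _ (norm_squareLoop t), norm_neg, neg_div] at h1
  exact div_ne_zero (hk0 _) (Complex.ofReal_ne_zero.2 (hkn _)) (self_eq_neg.1 h1)

/-- A face with four vertices would contain an embedded 3-ball. Shrunk into a chart domain, it would
embed in Euclidean space of dimension at most 2, hence in the plane. -/
theorem Triangulation.card_le_three {κ S H : Type*} [TopologicalSpace S] [TopologicalSpace H]
    [ChartedSpace H S] {n : ℕ} (hn : n ≤ 2) (J : ModelWithCorners ℝ (EuclideanSpace ℝ (Fin n)) H)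
    (N : Triangulation κ S) {s : Finset κ} (hs : s ∈ N.complex.faces) : s.card ≤ 3 := by
  classical
  by_contra! hcard
  obtain ⟨t, hts, ht⟩ := Finset.exists_subset_card_eq (Nat.succ_le_of_lt hcard)
  obtain ⟨d, t', hd, rfl, ht'⟩ := Finset.card_eq_succ.1 ht
  obtain ⟨a, b, c, hab, hac, hbc, rfl⟩ := Finset.card_eq_three.1 ht'
  simp only [Finset.mem_insert, Finset.mem_singleton, not_or] at hd
  obtain ⟨hda, hdb, hdc⟩ := hd
  have hba := hab.symm
  have hca := hac.symm
  have hcb := hbc.symm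
  have hface := mem_faces_of_subset hs hts (Finset.insert_nonempty _ _)
  -- The origin goes to the barycentre, and the factor 1/12 keeps all four coordinates nonnegative
  -- on the unit ball.
  let w : (ℝ × ℝ) × ℝ → κ → ℝ := fun x i =>
    if i = a then (3 + x.1.1) / 12 else if i = b then (3 + x.1.2) / 12 else
    if i = c then (3 + x.2) / 12 else if i = d then (3 - x.1.1 - x.1.2 - x.2) / 12 else 0
  have hw : MapsTo w (closedBall 0 1) (stdFace (insert d {a, b, c})) := by
    intro x hx
    rw [mem_closedBall_zero_iff, Prod.norm_def, Prod.norm_def, sup_le_iff, sup_le_iff,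
      Real.norm_eq_abs, Real.norm_eq_abs, Real.norm_eq_abs, abs_le, abs_le, abs_le] at hx
    obtain ⟨⟨⟨h1, h2⟩, h3, h4⟩, h5, h6⟩ := hx
    refine ⟨fun i => ?_, fun i hi => ?_, ?_⟩
    · simp only [w]
      split_ifs <;> linarith
    · simp only [Finset.mem_insert, Finset.mem_singleton, not_or] at hi
      simp [w, hi.1, hi.2.1, hi.2.2.1, hi.2.2.2]
    · rw [Finset.sum_insert (by simp [hda, hdb, hdc]), Finset.sum_insert (by simp [hab, hac]),
        Finset.sum_pair hbc]
      simp only [w, if_true, if_neg hba, if_neg hca, if_neg hcb, if_neg hda, if_neg hdb, if_neg hdc]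
      ring
  have hwc : ∀ i, Continuous fun x => w x i := by
    intro i
    simp only [w]
    split_ifs <;> fun_prop
  obtain ⟨q, hq, hqw⟩ := N.exists_map_of_coords hface hw hwc
  have hqinj : InjOn q (closedBall 0 1) := by
    intro x hx y hy h
    have key : ∀ i, w x i = w y i := fun i => by rw [← hqw x hx, ← hqw y hy, h]
    have h1 := key a
    have h2 := key b
    have h3 := key c
    simp only [w, if_true, if_neg hba, if_neg hca, if_neg hcb] at h1 h2 h3
    exact Prod.ext (Prod.ext (by linarith) (by linarith)) (by linarith)
  -- shrink the ball into a chart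
  have h0 : q ⁻¹' (extChartAt J (q 0)).source ∈ 𝓝 (0 : (ℝ × ℝ) × ℝ) :=
    (hq.continuousAt (closedBall_mem_nhds _ one_pos)).preimage_mem_nhds
      (extChartAt_source_mem_nhds (q 0))
  obtain ⟨ε, hε, hεsub⟩ := Metric.mem_nhds_iff.1 h0
  let r : ℝ := min 1 (ε / 2)
  have hr0 : 0 < r := lt_min one_pos (half_pos hε)
  have hr : ∀ x ∈ closedBall (0 : (ℝ × ℝ) × ℝ) 1,
      r • x ∈ closedBall (0 : (ℝ × ℝ) × ℝ) 1 ∧ q (r • x) ∈ (extChartAt J (q 0)).source := by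
    intro x hx
    have hxn : ‖r • x‖ ≤ r := by
      rw [norm_smul, Real.norm_eq_abs, abs_of_pos hr0]
      exact mul_le_of_le_one_right hr0.le (mem_closedBall_zero_iff.1 hx)
    refine ⟨mem_closedBall_zero_iff.2 (hxn.trans (min_le_left _ _)), hεsub ?_⟩
    rw [mem_ball_zero_iff]
    exact (hxn.trans (min_le_right _ _)).trans_lt (half_lt_self hε)
  -- Missing coordinates are filled with 0, which treats `n = 0, 1, 2` at once.
  let ψ : EuclideanSpace ℝ (Fin n) → ℂ := fun v =>
    ((if h : 0 < n then v ⟨0, h⟩ else 0 : ℝ) : ℂ) + ((if h : 1 < n then v ⟨1, h⟩ else 0 : ℝ) : ℂ) *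
      Complex.I
  have hψ : Continuous ψ := by
    simp only [ψ]
    split_ifs <;> fun_prop
  have hψ_inj : Function.Injective ψ := by
    intro v v' h
    have hre := congrArg Complex.re h
    have him := congrArg Complex.im h
    simp only [ψ, Complex.add_re, Complex.add_im, Complex.mul_re, Complex.mul_im, Complex.ofReal_re,
      Complex.ofReal_im, Complex.I_re, Complex.I_im, mul_zero, mul_one, zero_add, add_zero,
      sub_zero] at hre him
    ext ⟨i, hi⟩
    obtain rfl | rfl : i = 0 ∨ i = 1 := by omega
    · simpa [hi] using hre
    · simpa [hi] using him
  refine not_injOn_of_continuousOn (g := fun x => ψ (extChartAt J (q 0) (q (r • x)))) ?_ ?_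
  · refine hψ.comp_continuousOn ((continuousOn_extChartAt (q 0)).comp
      (hq.comp (by fun_prop) fun x hx => (hr x hx).1) fun x hx => (hr x hx).2)
  · intro x hx y hy h
    have h1 := (extChartAt J (q 0)).injOn (hr x hx).2 (hr y hy).2 (hψ_inj h)
    have h2 := hqinj (hr x hx).1 (hr y hy).1 h1
    exact smul_right_injective _ hr0.ne' h2

end

/-! ### Compression over the triangulation and the conclusion. -/

section

open Set Topology AbstractSimplicialComplex

theorem compresses_compl {E X : Type*} [NormedAddCommGroup E] [TopologicalSpace X] {Y : Set X} :
    Compresses E Y Yᶜ := fun u hu huV _ =>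
  ⟨fun p => u p.1, hu.comp continuousOn_fst fun _ hp => hp.1, fun _ hp => huV hp.1,
    fun _ _ => rfl, fun _ _ _ _ => rfl, fun _ hx => huV hx⟩

/-- If points, intervals and squares can be compressed off `Y`, then so can maps from compact
triangulated spaces of dimension at most two, relative to a subcomplex already mapped off `Y`. -/
theorem Triangulation.exists_homotopicRel_off {κ S X : Type*} [TopologicalSpace S] [T2Space S]
    [CompactSpace S] [TopologicalSpace X] {Y : Set X}
    (h0 : Compresses PUnit.{1} Y univ) (h1 : Compresses ℝ Y univ) (h2 : Compresses (ℝ × ℝ) Y univ)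
    (N : Triangulation κ S) (hN : ∀ s ∈ N.complex.faces, s.card ≤ 3) {S' : Set S}
    (hS' : N.IsSubcomplex S') (f : C(S, X)) (hf : MapsTo f S' Yᶜ) :
    ∃ h : C(S, X), f.HomotopicRel h S' ∧ Disjoint (range h) Y := by
  have := N.finite_faces.to_subtype
  have hcover : ⋃ c : N.complex.faces, N.simplex c = univ := eq_univ_of_forall fun x =>
    mem_iUnion.2 ⟨⟨_, N.support_coord_mem x⟩, Finset.Subset.refl _⟩
  obtain ⟨F, hF, hFc⟩ := exists_homotopy_of_cellExtends (Y := Y)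
    (fun c : N.complex.faces => c.1.card - 1) (fun b c => b.1 ⊂ c.1) (fun c => N.simplex c)
    (fun _ => univ) (fun c => N.simplex c ⊆ S') (fun c => N.isClosed_simplex c)
    (fun b c h => by
      have h1 := Finset.card_lt_card h
      have h2 := (nonempty_of_mem_faces b.2).card_pos
      omega)
    (fun b c h => N.simplex_mono h.1) (fun _ _ _ => subset_rfl)
    (fun b c h hc => (N.simplex_mono h.1).trans hc)
    -- The face carrying `x` lies in both `c` and `d`. Were it all of `c`, then `c` would lie in
    -- `d`, and the rank condition would force `c = d`.
    (fun c d hdc hr => by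
      rintro x ⟨hxd, hxc⟩
      refine mem_iUnion₂.2 ⟨⟨_, N.support_coord_mem x⟩, ?_, Finset.Subset.refl _⟩
      refine Finset.ssubset_iff_subset_ne.2 ⟨hxc, fun h => hdc (Subtype.ext ?_)⟩
      have h1 : (N.coord x).support ⊆ d.1 := hxd
      simp only at h
      rw [h] at h1
      have h2 := (nonempty_of_mem_faces c.2).card_pos
      exact (Finset.eq_of_subset_of_card_le h1 (by omega)).symm)
    f.continuous.continuousOn (fun _ _ _ => trivial) (fun c hc x hx => hf (hc hx))
    (fun c _ => N.cellExtends_of_card_le_three h0 h1 h2 c (hN _ c.2))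
  rw [hcover] at hF
  have hex : ∀ x, ∃ c : N.complex.faces, x ∈ N.simplex c := fun x =>
    mem_iUnion.1 (hcover ▸ mem_univ x)
  have hG : Continuous fun p : unitInterval × S => F (p.2, 3 * p.1) :=
    hF.comp_continuous (by fun_prop) fun p => ⟨trivial, mul_nonneg (by norm_num) p.1.2.1⟩
  refine ⟨⟨fun x => F (x, 3), hF.comp_continuous (by fun_prop) fun x =>
    ⟨trivial, by norm_num [mem_Ici]⟩⟩, ⟨⟨⟨⟨_, hG⟩, ?_, ?_⟩, ?_⟩⟩, ?_⟩
  · intro x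
    obtain ⟨c, hc⟩ := hex x
    simpa using (hFc c x hc).1
  · intro x
    simp
  · intro t x hx
    -- A point of the subcomplex lies in a simplex contained in it, and that cell was held fixed.
    obtain ⟨A, hA, rfl⟩ := hS'
    obtain ⟨s, hs, hxs⟩ := mem_iUnion₂.1 hx
    exact (hFc ⟨s, hA hs⟩ x hxs).2.1 (subset_biUnion_of_mem (u := N.simplex) hs) _
      (mul_nonneg (by norm_num) t.2.1)
  · rw [disjoint_left]
    rintro _ ⟨x, rfl⟩
    obtain ⟨c, hc⟩ := hex x
    obtain ⟨-, -, -, h4, h5⟩ := hFc c x hc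
    have hr : ((c.1.card - 1 : ℕ) + 1 : ℝ) ≤ 3 := by
      have := hN _ c.2
      exact_mod_cast (by omega : c.1.card - 1 + 1 ≤ 3)
    change F (x, 3) ∉ Y
    rw [h4 3 hr]
    exact h5

end

theorem proposition5p5
    {ι X : Type*} [TopologicalSpace X] (T : Triangulation ι X)
    (Y : Set X) (hY : T.IsSubcomplex Y)
    (h₁ : Dense Yᶜ)
    (h₂ : ∀ y ∈ Y, ∀ U : Set X, IsOpen U → y ∈ U →
      ∃ V ⊆ U, IsOpen V ∧ y ∈ V ∧ IsPathConnected (V \ Y))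
    (h₃ : ∀ y ∈ Y, ∃ V : Set X, IsOpen V ∧ y ∈ V ∧ IsPathConnected V ∧
      (∀ v : V, Subsingleton (HomotopyGroup.Pi 2 V v)) ∧
      ∀ v : ↥(V \ Y), Function.Injective
        (FundamentalGroup.map
          (⟨Set.inclusion Set.sdiff_subset, continuous_inclusion Set.sdiff_subset⟩ :
            C(↥(V \ Y), V)) v))
    {n : ℕ} (hn : n ≤ 2)
    {H : Type*} [TopologicalSpace H] (I : ModelWithCorners ℝ (EuclideanSpace ℝ (Fin n)) H)
    {S : Type*} [TopologicalSpace S] [T2Space S] [CompactSpace S] [ChartedSpace H S]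
    {κ : Type*} (N : Triangulation κ S)
    (S' : Set S) (hS' : N.IsSubcomplex S') (hbd : I.boundary S ⊆ S')
    (f : C(S, X)) (hf : Set.MapsTo f S' Yᶜ) (hfs : N.IsSimplicialOn T S' f) :
    ∃ h : C(S, X), f.HomotopicRel h S' ∧ Disjoint (Set.range h) Y := by
  have hX : LocallyContractible X := fun x U hU hx => T.exists_contractible_nhd x hU hx
  have hYc : IsClosed Y := hY.isClosed
  have c0 : ∀ V : Set X, IsOpen V → Compresses PUnit.{1} Y V := fun V hV => hX.compresses_point h₁ hV
  have c1 : ∀ V : Set X, IsOpen V → Compresses ℝ Y V := fun V hV =>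
    hX.compresses_interval hYc h₁ h₂ hV
  have c2 : Compresses (ℝ × ℝ) Y Set.univ := by
    -- At points of `Y` the neighbourhood comes from `h₃`; at other points the open complement
    -- serves, with constant homotopies.
    refine compresses_square_of_local c0 c1 fun x => ?_
    by_cases hx : x ∈ Y
    · obtain ⟨V, hV, hxV, -, hπ₂, hπ₁⟩ := h₃ x hx
      exact ⟨V, hV, hxV, compresses_square hπ₂ hπ₁⟩
    · exact ⟨Yᶜ, hYc.isOpen_compl, hx, compresses_compl⟩
  exact N.exists_homotopicRel_off (c0 _ isOpen_univ) (c1 _ isOpen_univ) c2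
    (fun s hs => N.card_le_three hn I hs) hS' f hf
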